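/- Setting. Fix integers $\Delta\ge 0$ and $c\ge 1$ and finite alphabets of node inputs, half-edge inputs, node outputs and half-edge outputs. A network on $n\ge 1$ nodes consists of a simple graph $G$ with $n$ nodes and maximum degree at most $\Delta$, input labels on all nodes and half-edges, pairwise distinct identifiers from $\{1,\dots,n^c\}$, and at every node $v$ a numbering of the edges at $v$ by the ports $1,\dots,\deg(v)$. The radius-$r$ neighborhood $\mathcal N^r(v)$ consists of the nodes at distance at most $r$ from $v$ and the edges with at least one endpoint at distance at most $r-1$ from $v$, together with the root $v$ and all degrees (in $G$), inputs, identifiers and port numbers of these nodes; rooted neighborhoods are considered up to isomorphism. An LCL problem $\Pi$ is given by a constant radius $\rho$ and a finite list of allowed rooted radius-$\rho$ neighborhoods labeled with inputs, outputs and degrees (without identifiers and ports); an output labeling of the nodes and half-edges is a solution if the labeled radius-$\rho$ neighborhood of every node is isomorphic to an allowed one. Let $T\colon\mathbb N_+\to\mathbb N_0$ and $f\colon\mathbb N_+\to\mathbb N\cup\{\infty\}$ be computable and non-decreasing. A LOCAL algorithm with knowledge of an upper bound is a map $A$ that takes a number $N$, a rooted neighborhood $X$ and a number $t\in\mathbb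 N_0$ to an output (a node label and a half-edge label for every port) or to $\bot$ (continue). Only sensible algorithms are considered: if $X$ has radius $e$ (the largest distance of a node of $X$ from the root), then $A(N,X,t)=A(N,X,e+1)\ne\bot$ for all $t\ge e+1$. All nodes of an $n$-node network receive the same $N$, with the promise $n\le N\le f(n)$, and the node $v$ outputs $A(N,\mathcal N^t(v),t)$ for the least $t$ at which this is not $\bot$; it stops in round $t$. The algorithm solves $\Pi$ if for every network and every $N$ with $n\le N\le f(n)$ these outputs exist and form a solution. It runs within $T$ if, for all such networks and $N$, every node stops in some round $t\le T(n)$; its locality is the pointwise least function within which it runs. In uncomputable-LOCAL the map $A$ is arbitrary; in computable-LOCAL it is a computable function of $(N,X,t)$. Theorem. Suppose that an uncomputable-LOCAL algorithm $A$ with knowledge of an upper bound $N$, $n\le N\le f(n)$, solves an LCL problem $\Pi$ and runs within $T$. Then there is a computable-LOCAL algorithm $B$, with knowledge of an upper bound $N$ under the same promise $n\le N\le f(n)$, that solves $\Pi$ and runs within $T$. Moreover, if $T$ is exactly the locality of $A$, then $B$ can be chosen such that $T$ is exactly the locality of $B$. -/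

import Mathlib

namespace LocalModel

/-- The radius-`r` neighborhood of `v`: all nodes at distance at most `r` from `v`, and all edges
with at least one endpoint at distance at most `r - 1` from `v`. -/
def neighborhood {V : Type*} (G : SimpleGraph V) (v : V) (r : ℕ) : G.Subgraph where
  verts := {u | G.edist v u ≤ r}
  Adj u w := G.Adj u w ∧ (G.edist v u < r ∨ G.edist v w < r)
  adj_sub h := h.1
  edge_vert := by
    rintro u w ⟨h, h1 | h1⟩
    · exact h1.le
    · have h2 : G.edist v u ≤ G.edist v w + G.edist w u := SimpleGraph.edist_triangle
      have h3 : G.edist w u = 1 := SimpleGraph.edist_eq_one_iff_adj.mpr h.symm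
      rw [h3] at h2
      exact h2.trans (Order.add_one_le_of_lt h1)
  symm := ⟨fun _ _ h => ⟨h.1.symm, h.2.symm⟩⟩

/-- A network on `n` nodes of maximum degree at most `Δ`, with node inputs from an alphabet of size
`Vin` and half-edge inputs from an alphabet of size `Ein`. A half-edge `(u, {u, w})` is the dart
`(u, w)`. The port numbers at `v` are the elements of `Fin (deg v)`; the bijection `port v` with the
neighbors of `v` (that is, with the edges at `v`) forces `deg v` to be the degree of `v`.
Identifiers are distinct elements of `{1, …, n ^ c}`. -/
structure Network (Δ c Vin Ein : ℕ) (n : ℕ+) where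
  graph : SimpleGraph (Fin n)
  deg : Fin n → ℕ
  deg_le : ∀ v, deg v ≤ Δ
  port : ∀ v, Fin (deg v) ≃ graph.neighborSet v
  input : Fin n → Fin Vin
  halfInput : graph.Dart → Fin Ein
  ident : Fin n → ℕ
  ident_injective : Function.Injective ident
  ident_mem : ∀ v, ident v ∈ Finset.Icc 1 ((n : ℕ) ^ c)

/-- What is known about one node `u` of a rooted neighborhood: its identifier, its input label, and
the list, in the order of the ports of `u`, of the half-edge input at that port together with the
identifier of the node at the other end, if that edge belongs to the neighborhood. The length of the
list is the degree of `u` in the whole graph. -/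
abbrev NodeRecord (Vin Ein : ℕ) : Type := ℕ × Fin Vin × List (Fin Ein × Option ℕ)

/-- A rooted neighborhood up to isomorphism: as identifiers are unique, a node is represented by its
identifier. The first component is the root, the second one the list of all nodes. -/
abbrev View (Vin Ein : ℕ) : Type := ℕ × List (NodeRecord Vin Ein)

/-- A node label together with the labels of the half-edges at the node, in the order of ports. -/
abbrev Output (Vout Eout : ℕ) : Type := Fin Vout × List (Fin Eout)

namespace Network

variable {Δ c Vin Ein : ℕ} {n : ℕ+} (P : Network Δ c Vin Ein n)

/-- The half-edge at port `i` of `u`. -/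
def dart (u : Fin n) (i : Fin (P.deg u)) : P.graph.Dart := ⟨(u, P.port u i), (P.port u i).2⟩

open Classical in
/-- The record of the node `u` in the radius-`r` neighborhood of `v`. -/
noncomputable def record (v : Fin n) (r : ℕ) (u : Fin n) : NodeRecord Vin Ein :=
  (P.ident u, P.input u, List.ofFn fun i : Fin (P.deg u) =>
    (P.halfInput (P.dart u i),
      if (neighborhood P.graph v r).Adj u (P.port u i) then some (P.ident (P.port u i)) else none))

open Classical in
/-- The radius-`r` neighborhood rooted at `v`, its nodes listed by increasing identifier. -/
noncomputable def view (v : Fin n) (r : ℕ) : View Vin Ein :=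
  (P.ident v,
    ((((List.finRange n).filter fun u => u ∈ (neighborhood P.graph v r).verts).mergeSort
      fun u w => P.ident u ≤ P.ident w).map (P.record v r)))

/-- The radius-`r` neighborhood rooted at `v` has radius `e`: this is the largest distance from the
root to one of its nodes (which is less than `r` if `v` reaches no node at distance `r`). -/
def HasRadius (v : Fin n) (r e : ℕ) : Prop :=
  IsGreatest {d : ℕ | ∃ u ∈ (neighborhood P.graph v r).verts, P.graph.edist v u = d} e

end Network

/-- A finite rooted graph with node labels in `α`, half-edge labels in `β`, and a number (meant as
its degree in an ambient graph) at each node. -/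
structure Pattern (α β : Type) where
  size : ℕ
  graph : SimpleGraph (Fin size)
  root : Fin size
  deg : Fin size → ℕ
  node : Fin size → α
  half : graph.Dart → β

/-- A locally checkable labeling problem with finite alphabets for node inputs, half-edge inputs,
node outputs and half-edge outputs. The constraint is given by a constant radius and a finite set of
allowed labeled rooted neighborhoods of that radius. -/
structure LCL (Vin Ein Vout Eout : ℕ) where
  radius : ℕ
  allowed : Set (Pattern (Fin Vin × Fin Vout) (Fin Ein × Fin Eout))
  allowed_finite : allowed.Finite

namespace LCL

variable {Δ c Vin Ein Vout Eout : ℕ} {n : ℕ+}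

/-- The neighborhood of `v`, labeled with the inputs of `P` and the outputs `y` (nodes) and `z`
(half-edges), is isomorphic to the pattern `p`. Identifiers and ports play no role. -/
def Matches (p : Pattern (Fin Vin × Fin Vout) (Fin Ein × Fin Eout)) (r : ℕ)
    (P : Network Δ c Vin Ein n) (y : Fin n → Fin Vout) (z : P.graph.Dart → Fin Eout)
    (v : Fin n) : Prop :=
  ∃ φ : p.graph ≃g (neighborhood P.graph v r).coe,
    (φ p.root : Fin n) = v ∧
    (∀ i, p.deg i = P.deg (φ i)) ∧
    (∀ i, p.node i = (P.input (φ i), y (φ i))) ∧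
    ∀ (i j : Fin p.size) (h : p.graph.Adj i j),
      let d : P.graph.Dart :=
        ⟨(φ i, φ j), (neighborhood P.graph v r).adj_sub (φ.map_adj_iff.mpr h)⟩
      p.half ⟨(i, j), h⟩ = (P.halfInput d, z d)

/-- The output labeling `(y, z)` is a solution: the constraint holds at all nodes. -/
def IsSolution (L : LCL Vin Ein Vout Eout) (P : Network Δ c Vin Ein n)
    (y : Fin n → Fin Vout) (z : P.graph.Dart → Fin Eout) : Prop :=
  ∀ v, ∃ p ∈ L.allowed, Matches p L.radius P y z v

end LCL

/-- The value `N` is admissible as an upper bound on the size `n`: `n ≤ N ≤ f n`. -/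
def Admissible (f : ℕ+ → ℕ∞) (n : ℕ+) (N : ℕ) : Prop := (n : ℕ) ≤ N ∧ (N : ℕ∞) ≤ f n

/-- A ball-growing algorithm in which all nodes are given a number `N`: an arbitrary function of
`N`, a rooted neighborhood and a number `t` of rounds, where `none` means to keep exploring.
Only sensible algorithms are considered: on a neighborhood of radius `e` in round `e + 1` or later,
so that the last round has revealed no new node, the algorithm stops, with an output
that is the same in all these rounds. -/
structure Algorithm (Δ c Vin Ein Vout Eout : ℕ) where
  run : ℕ → View Vin Ein → ℕ → Option (Output Vout Eout)
  sensible : ∀ (N : ℕ) (n : ℕ+) (P : Network Δ c Vin Ein n) (v : Fin n) (r e : ℕ),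
    P.HasRadius v r e → ∀ t, e + 1 ≤ t →
      run N (P.view v r) t = run N (P.view v r) (e + 1) ∧ run N (P.view v r) t ≠ none

namespace Algorithm

variable {Δ c Vin Ein Vout Eout : ℕ} (A : Algorithm Δ c Vin Ein Vout Eout)

/-- The node `v` outputs `o`: the value at the first radius where the algorithm does not continue. -/
def Outputs (N : ℕ) {n : ℕ+} (P : Network Δ c Vin Ein n) (v : Fin n) (o : Output Vout Eout) :
    Prop :=
  ∃ t, A.run N (P.view v t) t = some o ∧ ∀ s < t, A.run N (P.view v s) s = none

/-- On every network, with every admissible value of `N`, the outputs of the nodes are a solution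
of `L`. -/
def Solves (f : ℕ+ → ℕ∞) (L : LCL Vin Ein Vout Eout) : Prop :=
  ∀ (n : ℕ+) (P : Network Δ c Vin Ein n) (N : ℕ), Admissible f n N →
    ∃ (y : Fin n → Fin Vout) (z : P.graph.Dart → Fin Eout),
      (∀ v, A.Outputs N P v (y v, List.ofFn fun i => z (P.dart v i))) ∧ L.IsSolution P y z

/-- On every `n`-node network, with every admissible value of `N`, every node stops within `T n`
rounds. -/
def RunsWithin (f : ℕ+ → ℕ∞) (T : ℕ+ → ℕ) : Prop :=
  ∀ (n : ℕ+) (P : Network Δ c Vin Ein n) (N : ℕ), Admissible f n N →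
    ∀ v, ∃ t ≤ T n, A.run N (P.view v t) t ≠ none

/-- `T` is exactly the locality of the algorithm, the minimal function that bounds its number of
rounds. -/
def IsLocality (f : ℕ+ → ℕ∞) (T : ℕ+ → ℕ) : Prop := IsLeast {T' | A.RunsWithin f T'} T

/-- The algorithm is an algorithm of the computable model. -/
def IsComputable : Prop :=
  Computable fun a : ℕ × View Vin Ein × ℕ => A.run a.1 a.2.1 a.2.2

end Algorithm

/-- Computability of a function from positive integers to natural numbers. -/
def ComputableBound (T : ℕ+ → ℕ) : Prop := Computable fun k : ℕ => T k.succPNat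

/-- Computability of a function from positive integers to natural numbers or infinity, where `none`
is the code of infinity. -/
def ComputableExtBound (f : ℕ+ → ℕ∞) : Prop :=
  ∃ g : ℕ → Option ℕ, Computable g ∧ ∀ k : ℕ, f k.succPNat = (g k).elim ⊤ fun m => (m : ℕ∞)

end LocalModel

/-!
For a given `N` only finitely many networks have an admissible size, so that on them the behavior of
the given algorithm `A` is a finite table. A computable algorithm cannot know this table, but it can
search for any finite table of outputs that solves the problem on all of these networks, and
`exists_goodTable` shows, by means of `A`, that the search is successful.

The table contains outputs only; the stopping times are chosen as late as possible (`Stops`). A node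
stops in round `t` with view `X` if sensibility requires it, or if `X` is the view in round `t` of a
node of some network on `n` nodes with `n` admissible for `N` and `T n ≤ t`. The second condition
makes every node stop within `T n` rounds. In both cases `A` has stopped as well, since its behavior
up to round `t` is determined by `X` (`exists_run_ne_none_of_stops`). This has two consequences: the
outputs of `A` are available as entries of the table, and the new algorithm is nowhere faster than
`A`, so that its locality is `T` if that of `A` is.

To see that all of this is computable, networks are described by the lists of their records, sorted
by identifiers (`Network.records`). Such a list together with a root is itself a view, and `restrict`
computes from a view the views in earlier rounds (`Network.restrict_view`,
`Network.restrict_records`). The descriptions of all networks of a given size can be enumerated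
(`nets`, `Network.records_mem_nets`, `Network.exists_records_eq`), and the local constraint is a
primitive recursive condition on records (`matchesRecords_iff`, `primrecPred_goodTable`). The bounds
`T` and `f` enter only through the list of all pairs of an admissible size `n` and `T n`
(`exists_computable_bounds`).
-/

/-! ### Closure properties of primitive recursive and computable functions -/

section Computability

variable {α β γ σ : Type*} [Primcodable α] [Primcodable β] [Primcodable γ] [Primcodable σ]

theorem PrimrecPred.bex_mem {f : α → List β} {R : α → β → Prop} (hf : Primrec f)
    (hR : PrimrecPred fun p : α × β => R p.1 p.2) : PrimrecPred fun a => ∃ b ∈ f a, R a b :=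
  ((PrimrecRel.exists_mem_list (R := fun b a => R a b)
    (hR.comp (Primrec.snd.pair Primrec.fst))).comp hf Primrec.id)

theorem PrimrecPred.ball_mem {f : α → List β} {R : α → β → Prop} (hf : Primrec f)
    (hR : PrimrecPred fun p : α × β => R p.1 p.2) : PrimrecPred fun a => ∀ b ∈ f a, R a b :=
  ((PrimrecRel.forall_mem_list (R := fun b a => R a b)
    (hR.comp (Primrec.snd.pair Primrec.fst))).comp hf Primrec.id)

theorem PrimrecPred.bex_lt {f : α → ℕ} {R : α → ℕ → Prop} (hf : Primrec f)
    (hR : PrimrecPred fun p : α × ℕ => R p.1 p.2) : PrimrecPred fun a => ∃ k < f a, R a k :=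
  (PrimrecPred.bex_mem (Primrec.list_range.comp hf) hR).of_eq (by simp)

theorem PrimrecPred.const (p : Prop) : PrimrecPred fun _ : α => p := by
  classical exact ⟨fun _ => inferInstance, Primrec.const _⟩

theorem PrimrecPred.imp_const {p : Prop} {q : p → α → Prop} (h : ∀ hp, PrimrecPred (q hp)) :
    PrimrecPred fun a => ∀ hp : p, q hp a := by
  by_cases hp : p
  · exact (h hp).of_eq fun a => ⟨fun h _ => h, fun h => h hp⟩
  · exact (PrimrecPred.const True).of_eq fun a => ⟨fun _ h => absurd h hp, fun _ => trivial⟩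

theorem PrimrecPred.exists_mem_finite {ι : Type*} {s : Set ι} (hs : s.Finite) {q : ι → α → Prop}
    (h : ∀ i, PrimrecPred (q i)) : PrimrecPred fun a => ∃ i ∈ s, q i a := by
  induction s, hs using Set.Finite.induction_on with
  | empty => exact (PrimrecPred.const False).of_eq (by simp)
  | @insert i _ _ _ ih => exact ((h i).or ih).of_eq (by simp)

theorem PrimrecPred.forall_finite {ι : Type*} [Finite ι] {q : ι → α → Prop}
    (h : ∀ i, PrimrecPred (q i)) : PrimrecPred fun a => ∀ i, q i a :=
  (PrimrecPred.exists_mem_finite Set.finite_univ fun i => (h i).not).not.of_eq (by simp)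

theorem PrimrecPred.mem {f : α → β} {g : α → List β} (hf : Primrec f) (hg : Primrec g) :
    PrimrecPred fun a => f a ∈ g a :=
  (PrimrecPred.bex_mem (R := fun a b => b = f a) hg
    (Primrec.eq.comp Primrec.snd (hf.comp Primrec.fst))).of_eq (by simp)

theorem PrimrecRel.pairwise {R : α → α → Prop} (hR : PrimrecRel R) :
    PrimrecPred fun l : List α => l.Pairwise R := by
  classical
  refine Primrec.primrecPred (p := fun l : List α => l.Pairwise R) ?_
  refine (Primrec.list_rec (f := fun l : List α => l) (g := fun _ => true)
    (h := fun _ x => decide (∀ b ∈ x.2.1, R x.1 b) && x.2.2) Primrec.id (Primrec.const _)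
      (Primrec.and.comp ?_ (Primrec.snd.comp (Primrec.snd.comp Primrec.snd)))).of_eq ?_
  · refine PrimrecPred.decide (p := fun x : List α × α × List α × Bool => ∀ b ∈ x.2.2.1, R x.2.1 b)
      (PrimrecPred.ball_mem (Primrec.fst.comp (Primrec.snd.comp Primrec.snd)) ?_)
    exact hR.comp (Primrec.fst.comp (Primrec.snd.comp Primrec.fst)) Primrec.snd
  · intro l
    induction l with
    | nil => simp
    | cons a l ih => simp_all [List.pairwise_cons]

theorem Primrec.list_filter_mem {f : α → List β} {R : α → β → Prop} [∀ a, DecidablePred (R a)]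
    (hf : Primrec f) (hR : PrimrecPred fun p : α × β => R p.1 p.2) :
    Primrec fun a => (f a).filter fun b => R a b := by
  let _ : DecidableRel fun (b : β) (a : α) => R a b := fun b a => inferInstance
  exact ((PrimrecRel.listFilter (R := fun b a => R a b)
    (hR.comp (Primrec.snd.pair Primrec.fst))).comp hf Primrec.id)

theorem Primrec.list_product {f : α → List β} {g : α → List γ} (hf : Primrec f) (hg : Primrec g) :
    Primrec fun a => (f a).product (g a) :=
  Primrec.list_flatMap hf
    (Primrec.list_map (hg.comp Primrec.fst)
      ((Primrec.snd.comp Primrec.fst).pair Primrec.snd))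

theorem Primrec.nat_pow_const (c : ℕ) : Primrec fun n : ℕ => n ^ c := by
  induction c with
  | zero => exact (Primrec.const 1).of_eq (by simp)
  | succ c ih => exact (Primrec.nat_mul.comp ih Primrec.id).of_eq (by simp [pow_succ])

theorem Computable.filterMap_range {h : ℕ × ℕ → Option σ} (hh : Computable h) :
    Computable fun N => (List.range N).filterMap fun k => h (N, k) := by
  have h1 : Computable fun N : ℕ => (Nat.rec [] (fun k l => l ++ (h (N, k)).toList) N : List σ) :=
    Computable.nat_rec (f := fun N : ℕ => N) (g := fun _ => ([] : List σ))
      (h := fun N x => x.2 ++ (h (N, x.1)).toList) Computable.id (Computable.const _)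
      (Computable.list_append.comp (Computable.snd.comp Computable.snd)
        (Primrec.optionToList.to_comp.comp (hh.comp
          (Computable.fst.pair (Computable.fst.comp Computable.snd)))))
  have h2 (N m : ℕ) : (Nat.rec [] (fun k l => l ++ (h (N, k)).toList) m : List σ) =
      (List.range m).filterMap fun k => h (N, k) := by
    induction m with
    | zero => rfl
    | succ m ih =>
      rw [List.range_succ, List.filterMap_append, ← ih]
      cases hm : h (N, m) <;> simp [hm]
  exact h1.of_eq fun N => h2 N N

/-- A value that satisfies a decidable condition can be found by unbounded search. -/
theorem Computable.exists_choice {B : α → β} (hB : Computable B) {R : β → γ → Prop}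
    (hR : PrimrecPred fun x : β × γ => R x.1 x.2) (c₀ : γ) (hex : ∀ a, ∃ c, R (B a) c) :
    ∃ τ : α → γ, Computable τ ∧ ∀ a, R (B a) (τ a) := by
  classical
  have hd : Primrec fun k : ℕ => (Encodable.decode k : Option γ).getD c₀ :=
    Primrec.option_getD.comp Primrec.decode (Primrec.const c₀)
  have hex' (a : α) : ∃ k : ℕ, R (B a) ((Encodable.decode k).getD c₀) := by
    obtain ⟨c, hc⟩ := hex a
    exact ⟨Encodable.encode c, by simpa using hc⟩
  have hR' : PrimrecPred fun x : β × ℕ => R x.1 ((Encodable.decode x.2).getD c₀) :=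
    hR.comp (Primrec.fst.pair (hd.comp Primrec.snd))
  have hP : ComputablePred fun p : α × ℕ => R (B p.1) ((Encodable.decode p.2).getD c₀) :=
    Computable.computablePred
      (hR'.decide.to_comp.comp ((hB.comp Computable.fst).pair Computable.snd))
  exact ⟨_, hd.to_comp.comp (Computable.find (P := fun a k => R (B a)
    ((Encodable.decode k).getD c₀)) hP hex'), fun a => Nat.find_spec (hex' a)⟩

end Computability

namespace LocalModel

/-- All lists of length `d` with entries from `l`. -/
def lists {α : Type*} (l : List α) : ℕ → List (List α)
  | 0 => [[]]
  | d + 1 => (lists l d).flatMap fun t => l.map fun a => a :: t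

theorem mem_lists {α : Type*} {l : List α} {d : ℕ} {t : List α} :
    t ∈ lists l d ↔ t.length = d ∧ ∀ a ∈ t, a ∈ l := by
  induction d generalizing t with
  | zero => simp +contextual [lists]
  | succ d ih =>
    cases t with
    | nil => simp [lists]
    | cons a t => simp [lists, ih]; tauto

theorem primrec_lists {α β : Type*} [Primcodable α] [Primcodable β] {f : α → List β} {g : α → ℕ}
    (hf : Primrec f) (hg : Primrec g) : Primrec fun a => lists (f a) (g a) := by
  refine (Primrec.nat_rec' (f := g) (g := fun _ => ([[]] : List (List β)))
    (h := fun a x => x.2.flatMap fun t => (f a).map fun b => b :: t) hg (Primrec.const _)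
    (Primrec.list_flatMap (Primrec.snd.comp Primrec.snd) (Primrec.list_map
      (hf.comp (Primrec.fst.comp Primrec.fst)) (Primrec.list_cons.comp Primrec.snd
        (Primrec.snd.comp Primrec.fst))))).of_eq fun a => ?_
  induction g a with
  | zero => rfl
  | succ d ih => simp only [lists, ← ih]

/-! ### Balls and restriction of views -/

section Views

variable {Vin Ein : ℕ}

/-- The identifiers of the neighbors that a record mentions. -/
def targets (x : NodeRecord Vin Ein) : List ℕ := x.2.2.filterMap Prod.snd

/-- The identifiers of the nodes of the view `X` that are joined by an edge of `X` to a node with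
identifier in `S`. -/
def nbrs (X : View Vin Ein) (S : List ℕ) : List ℕ :=
  (X.2.filter fun x => x.1 ∈ S).flatMap targets

/-- The identifiers of the nodes at distance at most `k` from the root, with repetitions. -/
def ball (X : View Vin Ein) : ℕ → List ℕ
  | 0 => [X.1]
  | k + 1 => ball X k ++ nbrs X (ball X k)

/-- The identifiers of the nodes at distance less than `r` from the root, with repetitions. -/
def interior (X : View Vin Ein) : ℕ → List ℕ
  | 0 => []
  | k + 1 => ball X k

/-- The record `x` without the neighbors along edges that have no endpoint in `I`. -/
def trim (I : List ℕ) (x : NodeRecord Vin Ein) : NodeRecord Vin Ein :=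
  (x.1, x.2.1, x.2.2.map fun h =>
    (h.1, h.2.bind fun w => if x.1 ∈ I ∨ w ∈ I then some w else none))

/-- The radius-`r` neighborhood of the root of `X` inside of `X`. -/
def restrict (X : View Vin Ein) (r : ℕ) : View Vin Ein :=
  (X.1, (X.2.filter fun x => x.1 ∈ ball X r).map (trim (interior X r)))

/-- No node of `X` is at distance exactly `k + 1` from the root. -/
def Saturated (X : View Vin Ein) (k : ℕ) : Prop := ∀ a ∈ nbrs X (ball X k), a ∈ ball X k

instance (X : View Vin Ein) : DecidablePred (Saturated X) := fun _ => List.decidableBAll _ _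

/-- The smaller one of `t` and the radius of `X`, where `X` is the view of a node of a network. -/
def rad (X : View Vin Ein) (t : ℕ) : ℕ := (List.range t).findIdx fun k => decide (Saturated X k)

/-- The round for which the output on `X` in round `t` is looked up: a sensible algorithm gives the
same output in all rounds after the one in which it has seen all of `X`. -/
def cap (X : View Vin Ein) (t : ℕ) : ℕ := min t (rad X t + 1)

variable {α : Type*} [Primcodable α]

theorem primrec_targets : Primrec (targets (Vin := Vin) (Ein := Ein)) :=
  Primrec.listFilterMap (Primrec.snd.comp Primrec.snd) (Primrec.snd.comp Primrec.snd)

theorem primrec_nbrs {X : α → View Vin Ein} {S : α → List ℕ} (hX : Primrec X) (hS : Primrec S) :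
    Primrec fun a => nbrs (X a) (S a) :=
  Primrec.list_flatMap
    (Primrec.list_filter_mem (Primrec.snd.comp hX)
      (PrimrecPred.mem (Primrec.fst.comp Primrec.snd) (hS.comp Primrec.fst)))
    (primrec_targets.comp Primrec.snd)

theorem primrec_ball {X : α → View Vin Ein} {k : α → ℕ} (hX : Primrec X) (hk : Primrec k) :
    Primrec fun a => ball (X a) (k a) := by
  refine (Primrec.nat_rec' (f := k) (g := fun a => [(X a).1])
    (h := fun a x => x.2 ++ nbrs (X a) x.2) hk
    (Primrec.list_cons.comp (Primrec.fst.comp hX) (Primrec.const []))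
    (Primrec.list_append.comp (Primrec.snd.comp Primrec.snd)
      (primrec_nbrs (hX.comp Primrec.fst) (Primrec.snd.comp Primrec.snd)))).of_eq fun a => ?_
  induction k a with
  | zero => rfl
  | succ d ih => simp only [ball, ← ih]

theorem primrec_interior {X : α → View Vin Ein} {k : α → ℕ} (hX : Primrec X) (hk : Primrec k) :
    Primrec fun a => interior (X a) (k a) := by
  refine (Primrec.nat_casesOn (f := k) (g := fun _ => ([] : List ℕ))
    (h := fun a j => ball (X a) j) hk (Primrec.const [])
      (primrec_ball (hX.comp Primrec.fst) Primrec.snd)).of_eq fun a => ?_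
  cases k a <;> rfl

theorem primrec_trim {I : α → List ℕ} {x : α → NodeRecord Vin Ein} (hI : Primrec I)
    (hx : Primrec x) : Primrec fun a => trim (I a) (x a) := by
  refine (Primrec.fst.comp hx).pair (((Primrec.fst.comp (Primrec.snd.comp hx))).pair
    (Primrec.list_map (Primrec.snd.comp (Primrec.snd.comp hx))
      ((Primrec.fst.comp Primrec.snd).pair
        (Primrec.option_bind (Primrec.snd.comp Primrec.snd) ?_))))
  refine Primrec.ite (PrimrecPred.or (PrimrecPred.mem ?_ ?_) (PrimrecPred.mem ?_ ?_))
    (Primrec.option_some.comp Primrec.snd) (Primrec.const none)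
  · exact Primrec.fst.comp (hx.comp (Primrec.fst.comp Primrec.fst))
  · exact hI.comp (Primrec.fst.comp Primrec.fst)
  · exact Primrec.snd
  · exact hI.comp (Primrec.fst.comp Primrec.fst)

theorem primrec_restrict {X : α → View Vin Ein} {r : α → ℕ} (hX : Primrec X) (hr : Primrec r) :
    Primrec fun a => restrict (X a) (r a) :=
  (Primrec.fst.comp hX).pair (Primrec.list_map
    (Primrec.list_filter_mem (Primrec.snd.comp hX)
      (PrimrecPred.mem (Primrec.fst.comp Primrec.snd) ((primrec_ball hX hr).comp Primrec.fst)))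
    (primrec_trim ((primrec_interior hX hr).comp Primrec.fst) Primrec.snd))

theorem primrec_rad {X : α → View Vin Ein} {t : α → ℕ} (hX : Primrec X) (ht : Primrec t) :
    Primrec fun a => rad (X a) (t a) := by
  refine Primrec.list_findIdx (Primrec.list_range.comp ht) ?_
  refine PrimrecPred.decide (p := fun x : α × ℕ => Saturated (X x.1) x.2) ?_
  have hb : Primrec fun x : α × ℕ => ball (X x.1) x.2 :=
    primrec_ball (hX.comp Primrec.fst) Primrec.snd
  exact PrimrecPred.ball_mem (primrec_nbrs (hX.comp Primrec.fst) hb)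
    (PrimrecPred.mem Primrec.snd (hb.comp Primrec.fst))

theorem primrec_cap {X : α → View Vin Ein} {t : α → ℕ} (hX : Primrec X) (ht : Primrec t) :
    Primrec fun a => cap (X a) (t a) :=
  Primrec.nat_min.comp ht (Primrec.succ.comp (primrec_rad hX ht))

end Views

/-! ### Enumeration of the networks of a given size -/

section Enumeration

variable {Vin Ein : ℕ}

/-- The list `C` of records describes a whole network: it is sorted by identifiers, which are
positive, no node mentions a neighbor twice or itself, and adjacency is symmetric. -/
def IsNet (C : List (NodeRecord Vin Ein)) : Prop :=
  C.Pairwise (fun x y => x.1 < y.1) ∧ ∀ x ∈ C, 0 < x.1 ∧ (x.2.2.map Prod.snd).Pairwise (· ≠ ·) ∧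
    ∀ h ∈ x.2.2, ∃ y ∈ C, h.2 = some y.1 ∧ y.1 ≠ x.1 ∧ x.1 ∈ targets y

/-- All records with identifiers at most `m`, at most `Δ` ports and no unknown neighbors. -/
def recordList (Δ Vin Ein m : ℕ) : List (NodeRecord Vin Ein) :=
  (List.range (m + 1)).product ((List.finRange Vin).product ((List.range (Δ + 1)).flatMap fun d =>
    lists ((List.finRange Ein).product ((List.range (m + 1)).map some)) d))

open Classical in
/-- The descriptions of all networks on `n` nodes. -/
noncomputable def nets (Δ c Vin Ein n : ℕ) : List (List (NodeRecord Vin Ein)) :=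
  (lists (recordList Δ Vin Ein (n ^ c)) n).filter fun C => IsNet C

theorem mem_recordList {Δ m : ℕ} {x : NodeRecord Vin Ein} :
    x ∈ recordList Δ Vin Ein m ↔ x.1 ≤ m ∧ x.2.2.length ≤ Δ ∧
      ∀ h ∈ x.2.2, ∃ w ≤ m, h.2 = some w := by
  obtain ⟨a, i, l⟩ := x
  rw [recordList, List.pair_mem_product, List.pair_mem_product]
  simp only [List.mem_range, List.mem_finRange, List.mem_flatMap, mem_lists, true_and,
    Nat.lt_succ_iff]
  refine and_congr_right fun _ => ⟨?_, ?_⟩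
  · rintro ⟨d, hd, rfl, hl⟩
    refine ⟨hd, fun h hh => ?_⟩
    obtain ⟨h1, h2⟩ := h
    have := (List.pair_mem_product.1 (hl _ hh)).2
    obtain ⟨w, hw, rfl⟩ := List.mem_map.1 this
    exact ⟨w, Nat.lt_succ_iff.1 (List.mem_range.1 hw), rfl⟩
  · rintro ⟨hd, hl⟩
    refine ⟨_, hd, rfl, fun h hh => ?_⟩
    obtain ⟨w, hw, e⟩ := hl h hh
    obtain ⟨h1, h2⟩ := h
    exact List.pair_mem_product.2 ⟨List.mem_finRange _,
      List.mem_map.2 ⟨w, List.mem_range.2 (Nat.lt_succ_iff.2 hw), e.symm⟩⟩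

theorem mem_nets {Δ c n : ℕ} {C : List (NodeRecord Vin Ein)} :
    C ∈ nets Δ c Vin Ein n ↔
      C.length = n ∧ (∀ x ∈ C, x ∈ recordList Δ Vin Ein (n ^ c)) ∧ IsNet C := by
  simp [nets, mem_lists, and_assoc]

variable {α : Type*} [Primcodable α]

theorem primrecPred_isNet : PrimrecPred (IsNet (Vin := Vin) (Ein := Ein)) := by
  refine PrimrecPred.and (PrimrecRel.pairwise (R := fun x y : NodeRecord Vin Ein => x.1 < y.1) ?_)
    (PrimrecPred.ball_mem Primrec.id (PrimrecPred.and ?_ (PrimrecPred.and ?_ ?_)))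
  · exact Primrec.nat_lt.comp (Primrec.fst.comp Primrec.fst) (Primrec.fst.comp Primrec.snd)
  · exact Primrec.nat_lt.comp (Primrec.const 0) (Primrec.fst.comp Primrec.snd)
  · exact (PrimrecRel.pairwise (R := fun x y : Option ℕ => x ≠ y)
      (PrimrecPred.not Primrec.eq)).comp
      (Primrec.list_map (Primrec.snd.comp (Primrec.snd.comp Primrec.snd))
        (Primrec.snd.comp Primrec.snd))
  · refine PrimrecPred.ball_mem (Primrec.snd.comp (Primrec.snd.comp Primrec.snd))
      (PrimrecPred.bex_mem (Primrec.fst.comp Primrec.fst)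
        (PrimrecPred.and ?_ (PrimrecPred.and ?_ ?_)))
    · exact Primrec.eq.comp (Primrec.snd.comp (Primrec.snd.comp Primrec.fst))
        (Primrec.option_some.comp (Primrec.fst.comp Primrec.snd))
    · exact (Primrec.eq.comp (Primrec.fst.comp Primrec.snd)
        (Primrec.fst.comp (Primrec.snd.comp (Primrec.fst.comp Primrec.fst)))).not
    · exact PrimrecPred.mem (Primrec.fst.comp (Primrec.snd.comp (Primrec.fst.comp Primrec.fst)))
        (primrec_targets.comp Primrec.snd)

theorem primrec_nets {Δ c : ℕ} {n : α → ℕ} (hn : Primrec n) :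
    Primrec fun a => nets Δ c Vin Ein (n a) := by
  have hr : Primrec fun a => List.range ((n a) ^ c + 1) :=
    Primrec.list_range.comp (Primrec.succ.comp ((Primrec.nat_pow_const c).comp hn))
  classical
  refine Primrec.list_filter_mem (R := fun _ C => IsNet C) (primrec_lists ?_ hn)
    (primrecPred_isNet.comp Primrec.snd)
  refine Primrec.list_product hr (Primrec.list_product (Primrec.const _)
    (Primrec.list_flatMap (Primrec.const _) (primrec_lists ?_ Primrec.snd)))
  exact Primrec.list_product (Primrec.const _) (Primrec.list_map (hr.comp Primrec.fst)
    (Primrec.option_some.comp Primrec.snd))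

end Enumeration

/-! ### The algorithm given by a table of outputs -/

section Table

variable {Δ c Vin Ein Vout Eout : ℕ}

/-- The view `X` occurs in round `t` on a network with `b.1` nodes, for some `b ∈ B` with `b.2 ≤ t`.
An algorithm that stops within `b.2` rounds on networks with `b.1` nodes, for all `b ∈ B`, cannot
continue then. -/
def Forced (Δ c : ℕ) (B : List (ℕ × ℕ)) (X : View Vin Ein) (t : ℕ) : Prop :=
  ∃ b ∈ B, b.2 ≤ t ∧ ∃ C ∈ nets Δ c Vin Ein b.1, ∃ x ∈ C, restrict (x.1, C) t = X

/-- In round `t` with view `X` a sensible algorithm as in `Forced` cannot continue: either all of `X`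
was explored in an earlier round or the bound on the running time is reached on some network. -/
def Stops (Δ c : ℕ) (B : List (ℕ × ℕ)) (X : View Vin Ein) (t : ℕ) : Prop :=
  rad X t < t ∨ Forced Δ c B X t

/-- A finite partial function that assigns outputs to pairs of a view and a round, encoded as an
association list. -/
abbrev Table (Vin Ein Vout Eout : ℕ) : Type := List ((View Vin Ein × ℕ) × Output Vout Eout)

open Classical in
/-- The algorithm that stops as late as possible, with outputs from the table `τ`. The output `o₀`
is used where the table has no entry. -/
noncomputable def runTable (Δ c : ℕ) (o₀ : Output Vout Eout) (B : List (ℕ × ℕ))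
    (τ : Table Vin Ein Vout Eout) (X : View Vin Ein) (t : ℕ) : Option (Output Vout Eout) :=
  if Stops Δ c B X t then some ((τ.lookup (X, cap X t)).getD o₀) else none

/-- The first value of `R` other than `none`, among the arguments up to `m`, or else `o₀`. -/
def firstOut {σ : Type*} (o₀ : σ) (R : ℕ → Option σ) (m : ℕ) : σ :=
  ((List.range (m + 1)).filterMap R).head?.getD o₀

/-- The output of the node with identifier `a` in the network described by `C` if the outputs come
from the table `τ`, where `m` is a bound on the running time. -/
noncomputable def tableOut (Δ c : ℕ) (o₀ : Output Vout Eout) (B : List (ℕ × ℕ))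
    (τ : Table Vin Ein Vout Eout) (C : List (NodeRecord Vin Ein)) (m a : ℕ) : Output Vout Eout :=
  firstOut o₀ (fun t => runTable Δ c o₀ B τ (restrict (a, C) t) t) m

variable {α : Type*} [Primcodable α]

theorem primrecPred_forced {B : α → List (ℕ × ℕ)} {X : α → View Vin Ein} {t : α → ℕ}
    (hB : Primrec B) (hX : Primrec X) (ht : Primrec t) :
    PrimrecPred fun a => Forced Δ c (B a) (X a) (t a) := by
  refine PrimrecPred.bex_mem hB (PrimrecPred.and
    (Primrec.nat_le.comp (Primrec.snd.comp Primrec.snd) (ht.comp Primrec.fst))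
    (PrimrecPred.bex_mem (primrec_nets (Primrec.fst.comp Primrec.snd))
      (PrimrecPred.bex_mem Primrec.snd ?_)))
  have h1 : Primrec fun x : ((α × ℕ × ℕ) × List (NodeRecord Vin Ein)) × NodeRecord Vin Ein =>
    x.1.1.1 := Primrec.fst.comp (Primrec.fst.comp Primrec.fst)
  exact Primrec.eq.comp (primrec_restrict ((Primrec.fst.comp Primrec.snd).pair
    (Primrec.snd.comp Primrec.fst)) (ht.comp h1)) (hX.comp h1)

theorem primrec_runTable {o₀ : Output Vout Eout} {B : α → List (ℕ × ℕ)}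
    {τ : α → Table Vin Ein Vout Eout} {X : α → View Vin Ein} {t : α → ℕ}
    (hB : Primrec B) (hτ : Primrec τ) (hX : Primrec X) (ht : Primrec t) :
    Primrec fun a => runTable Δ c o₀ (B a) (τ a) (X a) (t a) := by
  classical
  refine Primrec.ite (PrimrecPred.or (Primrec.nat_lt.comp (primrec_rad hX ht) ht)
    (primrecPred_forced hB hX ht)) (Primrec.option_some.comp ?_) (Primrec.const none)
  refine Primrec.option_getD.comp ?_ (Primrec.const _)
  convert Primrec.listLookup.comp (hX.pair (primrec_cap hX ht)) hτ

theorem primrec_tableOut {o₀ : Output Vout Eout} {B : α → List (ℕ × ℕ)}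
    {τ : α → Table Vin Ein Vout Eout} {C : α → List (NodeRecord Vin Ein)} {m a : α → ℕ}
    (hB : Primrec B) (hτ : Primrec τ) (hC : Primrec C) (hm : Primrec m) (ha : Primrec a) :
    Primrec fun x => tableOut Δ c o₀ (B x) (τ x) (C x) (m x) (a x) := by
  refine Primrec.option_getD.comp (Primrec.list_head?.comp (Primrec.listFilterMap
    (Primrec.list_range.comp (Primrec.succ.comp hm)) ?_)) (Primrec.const _)
  exact primrec_runTable (hB.comp Primrec.fst) (hτ.comp Primrec.fst)
    (primrec_restrict ((ha.comp Primrec.fst).pair (hC.comp Primrec.fst)) Primrec.snd) Primrec.snd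

end Table

/-! ### Checking a table -/

section Check

variable {Δ c Vin Ein Vout Eout : ℕ}

/-- A node record together with the output of the node. -/
abbrev Labeled (Vin Ein Vout Eout : ℕ) : Type := NodeRecord Vin Ein × Output Vout Eout

/-- The nodes of the pattern `p` correspond bijectively to the labeled records in `D` via `a`, with
the root of `p` going to the node with identifier `r`, and this is an isomorphism. -/
structure IsMatch (p : Pattern (Fin Vin × Fin Vout) (Fin Ein × Fin Eout))
    (a : Fin p.size → Labeled Vin Ein Vout Eout) (D : List (Labeled Vin Ein Vout Eout)) (r : ℕ) :
    Prop where
  inj : ∀ i j, i ≠ j → (a i).1.1 ≠ (a j).1.1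
  surj : ∀ d ∈ D, ∃ i, (a i).1.1 = d.1.1
  root : (a p.root).1.1 = r
  deg : ∀ i, (a i).1.2.2.length = p.deg i
  node : ∀ i, ((a i).1.2.1, (a i).2.1) = p.node i
  adj : ∀ i j, p.graph.Adj i j ↔ (a j).1.1 ∈ targets (a i).1
  half : ∀ i j (h : p.graph.Adj i j), ∃ k < p.deg i,
    (a i).1.2.2[k]? = some ((p.half ⟨(i, j), h⟩).1, some (a j).1.1) ∧
    (a i).2.2[k]? = some (p.half ⟨(i, j), h⟩).2

/-- The labeled records `D`, rooted at the node with identifier `r`, are isomorphic to `p`. The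
isomorphism is encoded as a list indexed by the nodes of `p`; `d₀` is a padding value that is never
reached. -/
def MatchesRecords (d₀ : Labeled Vin Ein Vout Eout)
    (p : Pattern (Fin Vin × Fin Vout) (Fin Ein × Fin Eout)) (D : List (Labeled Vin Ein Vout Eout))
    (r : ℕ) : Prop :=
  ∃ l ∈ lists D p.size, IsMatch p (fun i => l.getD i d₀) D r

/-- The outputs that come from the table `τ` solve `L` on all networks with `b.1` nodes, for all
`b ∈ B`. -/
def GoodTable (Δ c : ℕ) (L : LCL Vin Ein Vout Eout) (d₀ : Labeled Vin Ein Vout Eout)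
    (B : List (ℕ × ℕ)) (τ : Table Vin Ein Vout Eout) : Prop :=
  ∀ b ∈ B, ∀ C ∈ nets Δ c Vin Ein b.1, ∀ x ∈ C,
    (tableOut Δ c d₀.2 B τ C b.2 x.1).2.length = x.2.2.length ∧
    ∃ p ∈ L.allowed, MatchesRecords d₀ p ((restrict (x.1, C) L.radius).2.map fun y =>
      (y, tableOut Δ c d₀.2 B τ C b.2 y.1)) x.1

/-- `IsMatch` as a conjunction of conditions of bounded quantifier form, in which everything that
depends only on the fixed pattern `p` is a constant. -/
theorem IsMatch.iff (p : Pattern (Fin Vin × Fin Vout) (Fin Ein × Fin Eout))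
    (a : Fin p.size → Labeled Vin Ein Vout Eout) (D : List (Labeled Vin Ein Vout Eout)) (r : ℕ) :
    IsMatch p a D r ↔ (∀ i j, i ≠ j → (a i).1.1 ≠ (a j).1.1) ∧ (∀ d ∈ D, ¬∀ i, (a i).1.1 ≠ d.1.1) ∧
      (a p.root).1.1 = r ∧ (∀ i, (a i).1.2.2.length = p.deg i) ∧
      (∀ i, ((a i).1.2.1, (a i).2.1) = p.node i) ∧
      (∀ i j, ∀ _ : p.graph.Adj i j, (a j).1.1 ∈ targets (a i).1) ∧
      (∀ i j, ∀ _ : ¬p.graph.Adj i j, (a j).1.1 ∉ targets (a i).1) ∧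
      (∀ i j (h : p.graph.Adj i j), ∃ k < p.deg i,
        (a i).1.2.2[k]? = some ((p.half ⟨(i, j), h⟩).1, some (a j).1.1) ∧
        (a i).2.2[k]? = some (p.half ⟨(i, j), h⟩).2) := by
  constructor
  · rintro ⟨h1, h2, h3, h4, h5, h6, h7⟩
    exact ⟨h1, by simpa using h2, h3, h4, h5, fun i j => (h6 i j).1,
      fun i j h h' => h ((h6 i j).2 h'), h7⟩
  · rintro ⟨h1, h2, h3, h4, h5, h6, h6', h7⟩
    exact ⟨h1, by simpa using h2, h3, h4, h5,
      fun i j => ⟨h6 i j, fun h => by_contra fun h' => h6' i j h' h⟩, h7⟩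

variable {α : Type*} [Primcodable α]

theorem primrecPred_isMatch (p : Pattern (Fin Vin × Fin Vout) (Fin Ein × Fin Eout))
    {a : Fin p.size → α → Labeled Vin Ein Vout Eout} {D : α → List (Labeled Vin Ein Vout Eout)}
    {r : α → ℕ} (ha : ∀ i, Primrec (a i)) (hD : Primrec D) (hr : Primrec r) :
    PrimrecPred fun x => IsMatch p (fun i => a i x) (D x) (r x) := by
  have hid (i) : Primrec fun x => (a i x).1.1 := Primrec.fst.comp (Primrec.fst.comp (ha i))
  have hl (i) : Primrec fun x => (a i x).1.2.2 :=
    Primrec.snd.comp (Primrec.snd.comp (Primrec.fst.comp (ha i)))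
  have hm (i j) : PrimrecPred fun x => (a j x).1.1 ∈ targets (a i x).1 :=
    PrimrecPred.mem (hid j) (primrec_targets.comp (Primrec.fst.comp (ha i)))
  refine PrimrecPred.of_eq (PrimrecPred.and ?_ (PrimrecPred.and ?_ (PrimrecPred.and ?_
    (PrimrecPred.and ?_ (PrimrecPred.and ?_ (PrimrecPred.and ?_ (PrimrecPred.and ?_ ?_)))))))
    fun x => (IsMatch.iff p (fun i => a i x) (D x) (r x)).symm
  · exact PrimrecPred.forall_finite fun i => PrimrecPred.forall_finite fun j =>
      PrimrecPred.imp_const fun _ => (Primrec.eq.comp (hid i) (hid j)).not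
  · refine PrimrecPred.ball_mem hD (PrimrecPred.not (PrimrecPred.forall_finite fun i => ?_))
    exact (Primrec.eq.comp ((hid i).comp Primrec.fst)
      (Primrec.fst.comp (Primrec.fst.comp Primrec.snd))).not
  · exact Primrec.eq.comp (hid _) hr
  · exact PrimrecPred.forall_finite fun i =>
      Primrec.eq.comp (Primrec.list_length.comp (hl i)) (Primrec.const _)
  · exact PrimrecPred.forall_finite fun i => Primrec.eq.comp
      ((Primrec.fst.comp (Primrec.snd.comp (Primrec.fst.comp (ha i)))).pair
        (Primrec.fst.comp (Primrec.snd.comp (ha i)))) (Primrec.const _)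
  · exact PrimrecPred.forall_finite fun i => PrimrecPred.forall_finite fun j =>
      PrimrecPred.imp_const fun _ => hm i j
  · exact PrimrecPred.forall_finite fun i => PrimrecPred.forall_finite fun j =>
      PrimrecPred.imp_const fun _ => (hm i j).not
  · refine PrimrecPred.forall_finite fun i => PrimrecPred.forall_finite fun j =>
      PrimrecPred.imp_const fun h => PrimrecPred.bex_lt (Primrec.const _) (PrimrecPred.and
        (Primrec.eq.comp (Primrec.list_getElem?.comp ((hl i).comp Primrec.fst) Primrec.snd) ?_)
        (Primrec.eq.comp (Primrec.list_getElem?.comp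
          ((Primrec.snd.comp (Primrec.snd.comp (ha i))).comp Primrec.fst) Primrec.snd)
          (Primrec.const _)))
    exact Primrec.option_some.comp ((Primrec.const _).pair
      (Primrec.option_some.comp ((hid j).comp Primrec.fst)))

theorem primrecPred_matchesRecords (d₀ : Labeled Vin Ein Vout Eout)
    (p : Pattern (Fin Vin × Fin Vout) (Fin Ein × Fin Eout))
    {D : α → List (Labeled Vin Ein Vout Eout)} {r : α → ℕ} (hD : Primrec D) (hr : Primrec r) :
    PrimrecPred fun x => MatchesRecords d₀ p (D x) (r x) :=
  PrimrecPred.bex_mem (primrec_lists hD (Primrec.const _)) (primrecPred_isMatch p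
    (a := fun i (x : α × List (Labeled Vin Ein Vout Eout)) => x.2.getD i d₀)
    (fun _ => (Primrec.list_getD d₀).comp Primrec.snd (Primrec.const _))
    (hD.comp Primrec.fst) (hr.comp Primrec.fst))

theorem primrecPred_goodTable (L : LCL Vin Ein Vout Eout) (d₀ : Labeled Vin Ein Vout Eout)
    {B : α → List (ℕ × ℕ)} {τ : α → Table Vin Ein Vout Eout} (hB : Primrec B) (hτ : Primrec τ) :
    PrimrecPred fun x => GoodTable Δ c L d₀ (B x) (τ x) := by
  have hx : Primrec fun x : ((α × ℕ × ℕ) × List (NodeRecord Vin Ein)) × NodeRecord Vin Ein =>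
    x.1.1.1 := Primrec.fst.comp (Primrec.fst.comp Primrec.fst)
  have hC : Primrec fun x : ((α × ℕ × ℕ) × List (NodeRecord Vin Ein)) × NodeRecord Vin Ein =>
    x.1.2 := Primrec.snd.comp Primrec.fst
  have hm : Primrec fun x : ((α × ℕ × ℕ) × List (NodeRecord Vin Ein)) × NodeRecord Vin Ein =>
    x.1.1.2.2 := Primrec.snd.comp (Primrec.snd.comp (Primrec.fst.comp Primrec.fst))
  have hi : Primrec fun x : ((α × ℕ × ℕ) × List (NodeRecord Vin Ein)) × NodeRecord Vin Ein =>
    x.2.1 := Primrec.fst.comp Primrec.snd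
  refine PrimrecPred.ball_mem hB (PrimrecPred.ball_mem
    (primrec_nets (Primrec.fst.comp Primrec.snd)) (PrimrecPred.ball_mem Primrec.snd
      (PrimrecPred.and ?_ (PrimrecPred.exists_mem_finite L.allowed_finite fun p => ?_))))
  · exact Primrec.eq.comp (Primrec.list_length.comp (Primrec.snd.comp
      (primrec_tableOut (hB.comp hx) (hτ.comp hx) hC hm hi)))
      (Primrec.list_length.comp (Primrec.snd.comp (Primrec.snd.comp Primrec.snd)))
  · refine primrecPred_matchesRecords d₀ p (Primrec.list_map
      (Primrec.snd.comp (primrec_restrict (hi.pair hC) (Primrec.const _)))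
        (Primrec.snd.pair ?_)) hi
    exact primrec_tableOut (hB.comp (hx.comp Primrec.fst)) (hτ.comp (hx.comp Primrec.fst))
      (hC.comp Primrec.fst) (hm.comp Primrec.fst) (Primrec.fst.comp Primrec.snd)

end Check

/-! ### Views as neighborhoods of networks -/

theorem edist_le_succ_iff {V : Type*} {G : SimpleGraph V} {v u : V} {k : ℕ} :
    G.edist v u ≤ (k + 1 : ℕ) ↔ G.edist v u ≤ k ∨ ∃ w, G.edist v w ≤ k ∧ G.Adj w u := by
  constructor
  · intro h
    by_cases hv : v = u
    · subst hv; left; simp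
    have hne : G.edist v u ≠ ⊤ := fun h' => by simp [h'] at h
    obtain ⟨p, hp⟩ := SimpleGraph.exists_walk_of_edist_ne_top hne
    cases hq : p.reverse with
    | nil => exact absurd rfl hv
    | cons hadj q =>
      right
      refine ⟨_, ?_, hadj.symm⟩
      have h1 : p.length = q.length + 1 := by
        rw [← SimpleGraph.Walk.length_reverse, hq, SimpleGraph.Walk.length_cons]
      have h2 := SimpleGraph.edist_le q.reverse
      rw [SimpleGraph.Walk.length_reverse] at h2
      refine h2.trans ?_
      rw [← hp, h1] at h
      norm_cast at h ⊢
      omega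
  · rintro (h | ⟨w, hw, hadj⟩)
    · exact h.trans (by norm_cast; omega)
    · refine SimpleGraph.edist_triangle.trans (b := G.edist v w + G.edist w u) ?_
      rw [SimpleGraph.edist_eq_one_iff_adj.2 hadj]
      push_cast
      gcongr

namespace Network

variable {Δ c Vin Ein : ℕ} {n : ℕ+} (P : Network Δ c Vin Ein n)

open Classical in
/-- The record of `u` when exactly the edges in `E` are visible. -/
noncomputable def genRecord (E : Fin n → Fin n → Prop) (u : Fin n) : NodeRecord Vin Ein :=
  (P.ident u, P.input u, List.ofFn fun i : Fin (P.deg u) =>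
    (P.halfInput (P.dart u i),
      if E u (P.port u i) then some (P.ident (P.port u i)) else none))

open Classical in
/-- The nodes in `U`, listed by increasing identifier. -/
noncomputable def sorted (U : Fin n → Prop) : List (Fin n) :=
  ((List.finRange n).filter fun u => U u).mergeSort fun u w => P.ident u ≤ P.ident w

/-- The view from `v` when exactly the nodes in `U` and the edges in `E` are visible. -/
noncomputable def genView (U : Fin n → Prop) (E : Fin n → Fin n → Prop) (v : Fin n) :
    View Vin Ein := (P.ident v, (P.sorted U).map (P.genRecord E))

/-- The description of the whole network by a list of records. -/
noncomputable def records : List (NodeRecord Vin Ein) :=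
  (P.sorted fun _ => True).map (P.genRecord P.graph.Adj)

theorem view_eq (v : Fin n) (r : ℕ) : P.view v r =
    P.genView (fun u => P.graph.edist v u ≤ r) (neighborhood P.graph v r).Adj v := by
  unfold view genView sorted genRecord record
  congr!

theorem records_eq (v : Fin n) :
    (P.ident v, P.records) = P.genView (fun _ => True) P.graph.Adj v := rfl

theorem mem_sorted {U : Fin n → Prop} {u : Fin n} : u ∈ P.sorted U ↔ U u := by
  simp [sorted]

theorem sorted_pairwise (U : Fin n → Prop) :
    (P.sorted U).Pairwise fun u w => P.ident u ≤ P.ident w := by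
  have := List.pairwise_mergeSort (le := fun u w => decide (P.ident u ≤ P.ident w))
    (fun a b c => by simpa using le_trans) (fun a b => by simpa using le_total _ _)
    ((List.finRange n).filter fun u => @decide (U u) (Classical.propDecidable _))
  simpa [sorted] using this

theorem sorted_nodup (U : Fin n → Prop) : (P.sorted U).Nodup :=
  (List.mergeSort_perm _ _).nodup_iff.2 ((List.nodup_finRange _).filter _)

theorem eq_sorted {U : Fin n → Prop} {l : List (Fin n)} (h1 : l.Nodup) (h2 : ∀ u, u ∈ l ↔ U u)
    (h3 : l.Pairwise fun u w => P.ident u ≤ P.ident w) : l = P.sorted U :=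
  List.Perm.eq_of_pairwise (fun _ _ _ _ h h' => P.ident_injective (le_antisymm h h')) h3
    (P.sorted_pairwise U)
    ((List.perm_ext_iff_of_nodup h1 (P.sorted_nodup U)).2 fun u => by rw [h2, mem_sorted])

theorem mem_targets {E : Fin n → Fin n → Prop} (hE : ∀ u w, E u w → P.graph.Adj u w) {u : Fin n}
    {a : ℕ} : a ∈ targets (P.genRecord E u) ↔ ∃ w, E u w ∧ P.ident w = a := by
  simp only [targets, genRecord, List.mem_filterMap, List.mem_ofFn]
  constructor
  · rintro ⟨_, ⟨i, rfl⟩, h⟩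
    by_cases hi : E u (P.port u i)
    · exact ⟨_, hi, by simpa [hi] using h⟩
    · simp [hi] at h
  · rintro ⟨w, hw, rfl⟩
    refine ⟨_, ⟨(P.port u).symm ⟨w, hE u w hw⟩, rfl⟩, ?_⟩
    simp [hw]

theorem mem_nbrs {U : Fin n → Prop} {E : Fin n → Fin n → Prop}
    (hE : ∀ u w, E u w → P.graph.Adj u w) {v : Fin n} {S : List ℕ} {a : ℕ} :
    a ∈ nbrs (P.genView U E v) S ↔ ∃ u w, P.ident u ∈ S ∧ U u ∧ E u w ∧ P.ident w = a := by
  simp only [nbrs, genView, List.mem_flatMap, List.mem_filter, List.mem_map, mem_sorted,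
    decide_eq_true_eq]
  constructor
  · rintro ⟨_, ⟨⟨u, hu, rfl⟩, hS⟩, ha⟩
    obtain ⟨w, hw, h⟩ := (P.mem_targets hE).1 ha
    exact ⟨u, w, hS, hu, hw, h⟩
  · rintro ⟨u, w, hS, hu, hw, h⟩
    exact ⟨_, ⟨⟨u, hu, rfl⟩, hS⟩, (P.mem_targets hE).2 ⟨w, hw, h⟩⟩

/-- A view that contains the radius-`s` neighborhood determines the balls up to radius `s`. -/
theorem mem_ball {U : Fin n → Prop} {E : Fin n → Fin n → Prop}
    (hE : ∀ u w, E u w → P.graph.Adj u w) {v : Fin n} {s : ℕ}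
    (hU : ∀ u, P.graph.edist v u ≤ s → U u)
    (hs : ∀ u w, (neighborhood P.graph v s).Adj u w → E u w) {k : ℕ} (hk : k ≤ s) {u : Fin n} :
    P.ident u ∈ ball (P.genView U E v) k ↔ P.graph.edist v u ≤ k := by
  induction k generalizing u with
  | zero =>
    simp only [ball, genView, List.mem_singleton, P.ident_injective.eq_iff, CharP.cast_eq_zero,
      nonpos_iff_eq_zero, SimpleGraph.edist_eq_zero_iff]
    exact eq_comm
  | succ k ih =>
    rw [ball, List.mem_append, ih (by omega), P.mem_nbrs hE, edist_le_succ_iff]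
    refine or_congr_right ⟨?_, ?_⟩
    · rintro ⟨w, u', hw, -, h, he⟩
      cases P.ident_injective he
      exact ⟨w, (ih (by omega)).1 hw, hE _ _ h⟩
    · rintro ⟨w, hw, h⟩
      have hks : (k : ℕ∞) < s := by norm_cast
      exact ⟨w, u, (ih (by omega)).2 hw, hU w (hw.trans hks.le),
        hs w u ⟨h, Or.inl (hw.trans_lt hks)⟩, rfl⟩

theorem mem_interior {U : Fin n → Prop} {E : Fin n → Fin n → Prop}
    (hE : ∀ u w, E u w → P.graph.Adj u w) {v : Fin n} {s : ℕ}
    (hU : ∀ u, P.graph.edist v u ≤ s → U u)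
    (hs : ∀ u w, (neighborhood P.graph v s).Adj u w → E u w) {u : Fin n} :
    P.ident u ∈ interior (P.genView U E v) s ↔ P.graph.edist v u < s := by
  cases s with
  | zero => simp [interior]
  | succ k =>
    rw [interior, P.mem_ball hE hU hs (Nat.le_succ k)]
    push_cast
    rw [ENat.lt_natCast_add_one_iff]

theorem restrict_genView {U : Fin n → Prop} {E : Fin n → Fin n → Prop}
    (hE : ∀ u w, E u w → P.graph.Adj u w) {v : Fin n} {s : ℕ}
    (hU : ∀ u, P.graph.edist v u ≤ s → U u)
    (hs : ∀ u w, (neighborhood P.graph v s).Adj u w → E u w) :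
    restrict (P.genView U E v) s = P.view v s := by
  rw [view_eq]
  have hb (u : Fin n) := P.mem_ball hE hU hs le_rfl (u := u)
  have hi (u : Fin n) := P.mem_interior hE hU hs (u := u)
  generalize hB : ball (P.genView U E v) s = B at hb
  generalize hI : interior (P.genView U E v) s = I at hi
  rw [restrict, hB, hI]
  refine Prod.ext rfl ?_
  simp only [genView]
  rw [List.filter_map, List.map_map]
  have h1 : ((P.sorted U).filter ((fun x : NodeRecord Vin Ein => decide (x.1 ∈ B)) ∘
      P.genRecord E)) = P.sorted fun u => P.graph.edist v u ≤ s := by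
    refine P.eq_sorted ((P.sorted_nodup U).filter _) (fun u => ?_) ((P.sorted_pairwise U).filter _)
    simp only [List.mem_filter, mem_sorted, Function.comp, genRecord, decide_eq_true_eq, hb]
    exact ⟨fun h => h.2, fun h => ⟨hU u h, h⟩⟩
  rw [h1]
  refine List.map_congr_left fun u _ => ?_
  simp only [Function.comp, trim, genRecord, List.map_ofFn]
  refine Prod.ext rfl (Prod.ext rfl ?_)
  refine congrArg List.ofFn (funext fun i => Prod.ext rfl ?_)
  have hadj : P.graph.Adj u (P.port u i) := (P.port u i).2
  simp only [Function.comp, hi]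
  by_cases hn : (neighborhood P.graph v s).Adj u (P.port u i)
  · have h2 := hn.2
    rw [if_pos hn, if_pos (hs _ _ hn), Option.bind_some, if_pos (h2.imp id (hi _).2)]
  · rw [if_neg hn]
    split_ifs with h3
    · rw [Option.bind_some, if_neg fun h => hn ⟨hadj, h.imp id (hi _).1⟩]
    · rfl

theorem neighborhood_mono {V : Type*} {G : SimpleGraph V} {v : V} {s t : ℕ} (h : s ≤ t) (u w : V)
    (hs : (neighborhood G v s).Adj u w) : (neighborhood G v t).Adj u w := by
  have : (s : ℕ∞) ≤ t := by norm_cast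
  exact ⟨hs.1, hs.2.imp (fun h => h.trans_le this) fun h => h.trans_le this⟩

/-- The view in round `t` determines the views in all earlier rounds. -/
theorem restrict_view {v : Fin n} {s t : ℕ} (h : s ≤ t) :
    restrict (P.view v t) s = P.view v s := by
  rw [view_eq P v t]
  exact P.restrict_genView (fun _ _ h => h.1) (fun u hu => hu.trans (by norm_cast))
    (neighborhood_mono h)

/-- The description of a whole network, rooted at `v`, determines all views from `v`. -/
theorem restrict_records (v : Fin n) (s : ℕ) :
    restrict (P.ident v, P.records) s = P.view v s := by
  rw [records_eq]
  exact P.restrict_genView (fun _ _ h => h) (fun u hu => trivial) (fun _ _ h => h.1)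

/-- The radius of a neighborhood can be read off from the view. -/
theorem saturated_view {v : Fin n} {r e : ℕ} (he : P.HasRadius v r e) {k : ℕ} :
    Saturated (P.view v r) k ↔ e ≤ k := by
  obtain ⟨⟨u, hu, hue⟩, hmax⟩ := he
  have hur : P.graph.edist v u ≤ r := hu
  have her : e ≤ r := by rw [hue] at hur; exact_mod_cast hur
  have hE (u w) (h : (neighborhood P.graph v r).Adj u w) : P.graph.Adj u w := h.1
  have hb {j : ℕ} (hj : j ≤ r) {u : Fin n} : P.ident u ∈ ball (P.view v r) j ↔
      P.graph.edist v u ≤ j := by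
    rw [view_eq]; exact P.mem_ball hE (fun _ h => h) (fun _ _ h => h) hj
  have hle {w : Fin n} (hw : P.graph.edist v w ≤ r) : P.graph.edist v w ≤ e := by
    obtain ⟨d, hd⟩ := ENat.ne_top_iff_exists.1 (ne_top_of_le_ne_top (ENat.natCast_ne_top r) hw)
    rw [← hd]
    exact_mod_cast hmax ⟨w, hw, hd.symm⟩
  have hmono {j k : ℕ} (h : j ≤ k) : ball (P.view v r) j ⊆ ball (P.view v r) k := by
    induction h with
    | refl => exact List.Subset.refl _
    | step _ ih => exact fun a ha => List.mem_append_left _ (ih ha)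
  constructor
  · intro hs
    by_contra! hlt
    have hstep (w : Fin n) (hw : P.graph.edist v w ≤ (k + 1 : ℕ)) : P.graph.edist v w ≤ k := by
      rw [← hb (by omega), ball, List.mem_append] at hw
      exact (hb (by omega)).1 (hw.elim id (hs _))
    -- A node farther away than `k` would make some node at distance exactly `k + 1` visible.
    have hall (j : ℕ) (w : Fin n) (hw : P.graph.edist v w ≤ (k + j : ℕ)) :
        P.graph.edist v w ≤ k := by
      induction j generalizing w with
      | zero => exact hw
      | succ j ih =>
        rcases edist_le_succ_iff.1 (show P.graph.edist v w ≤ (k + j + 1 : ℕ) from hw) with h | h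
        · exact ih w h
        · obtain ⟨x, hx, hxw⟩ := h
          exact hstep w (edist_le_succ_iff.2 (Or.inr ⟨x, ih x hx, hxw⟩))
    have := hall (e - k) u (by rw [hue]; norm_cast; omega)
    rw [hue] at this
    norm_cast at this
    omega
  · intro hk a ha
    rw [view_eq, P.mem_nbrs hE] at ha
    obtain ⟨w, x, -, -, h, rfl⟩ := ha
    have hx : P.graph.edist v x ≤ r := (neighborhood P.graph v r).edge_vert h.symm
    exact hmono hk ((hb her).2 (hle hx))

theorem rad_view {v : Fin n} {r e : ℕ} (he : P.HasRadius v r e) (t : ℕ) :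
    rad (P.view v r) t = min t e := by
  unfold rad
  simp only [P.saturated_view he]
  rcases le_or_gt t e with h | h
  · rw [min_eq_left h, List.findIdx_eq_length_of_false]
    · simp
    · intro x hx; simp at hx ⊢; omega
  · rw [min_eq_right h.le, List.findIdx_eq (by simpa using h)]
    simp

theorem exists_hasRadius (v : Fin n) (r : ℕ) : ∃ e, P.HasRadius v r e := by
  have hne : {d : ℕ | ∃ u ∈ (neighborhood P.graph v r).verts, P.graph.edist v u = d}.Nonempty :=
    ⟨0, v, by simp [neighborhood], by simp⟩
  have hbdd : BddAbove {d : ℕ | ∃ u ∈ (neighborhood P.graph v r).verts,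
      P.graph.edist v u = d} := by
    refine ⟨r, ?_⟩
    rintro d ⟨u, hu, hd⟩
    have hu' : P.graph.edist v u ≤ r := hu
    rw [hd] at hu'
    exact_mod_cast hu'
  exact ⟨_, Nat.sSup_mem hne hbdd, fun _ h => le_csSup hbdd h⟩

theorem HasRadius.of_lt {v : Fin n} {r e : ℕ} (he : P.HasRadius v r e) (h : e < r) :
    P.HasRadius v (e + 1) e := by
  obtain ⟨⟨u, hu, hue⟩, hmax⟩ := he
  refine ⟨⟨u, ?_, hue⟩, ?_⟩
  · show P.graph.edist v u ≤ (e + 1 : ℕ)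
    rw [hue]; norm_cast; omega
  · rintro d ⟨w, hw, hd⟩
    exact hmax ⟨w, le_trans (b := ((e + 1 : ℕ) : ℕ∞)) hw (by norm_cast), hd⟩

end Network

/-! ### Networks and their descriptions -/

namespace Network

variable {Δ c Vin Ein : ℕ} {n : ℕ+}

theorem mem_records {P : Network Δ c Vin Ein n} {x : NodeRecord Vin Ein} :
    x ∈ P.records ↔ ∃ u, P.genRecord P.graph.Adj u = x := by
  simp [records, mem_sorted]

theorem records_mem_nets (P : Network Δ c Vin Ein n) : P.records ∈ nets Δ c Vin Ein n := by
  refine mem_nets.2 ⟨?_, fun x hx => ?_, ?_, fun x hx => ?_⟩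
  · simp [records, sorted]
  · obtain ⟨u, rfl⟩ := mem_records.1 hx
    refine mem_recordList.2 ⟨(Finset.mem_Icc.1 (P.ident_mem u)).2, ?_, fun h hh => ?_⟩
    · simpa [genRecord] using P.deg_le u
    · obtain ⟨i, rfl⟩ := (List.mem_ofFn' _ _).1 hh
      exact ⟨_, (Finset.mem_Icc.1 (P.ident_mem (P.port u i))).2, if_pos (P.port u i).2⟩
  · refine List.pairwise_map.2 (((P.sorted_pairwise _).and (P.sorted_nodup _)).imp ?_)
    exact fun h => lt_of_le_of_ne h.1 fun h' => h.2 (P.ident_injective h')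
  · obtain ⟨u, rfl⟩ := mem_records.1 hx
    refine ⟨(Finset.mem_Icc.1 (P.ident_mem u)).1, ?_, fun h hh => ?_⟩
    · rw [genRecord, List.map_ofFn]
      refine List.nodup_ofFn.2 fun i j hij => ?_
      simp only [Function.comp, if_pos (show P.graph.Adj u _ from (P.port u i).2),
        if_pos (show P.graph.Adj u _ from (P.port u j).2), Option.some.injEq] at hij
      exact (P.port u).injective (Subtype.ext (P.ident_injective hij))
    · obtain ⟨i, rfl⟩ := (List.mem_ofFn' _ _).1 hh
      have hadj : P.graph.Adj u (P.port u i) := (P.port u i).2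
      refine ⟨_, mem_records.2 ⟨P.port u i, rfl⟩, if_pos hadj, fun h => ?_, ?_⟩
      · exact hadj.ne (P.ident_injective h).symm
      · exact (P.mem_targets fun _ _ h => h).2 ⟨u, hadj.symm, rfl⟩

/-- Every enumerated list of records is the description of an actual network, so that a table is
only asked to be correct where the given algorithm is. -/
theorem exists_records_eq {C : List (NodeRecord Vin Ein)} (hC : C ∈ nets Δ c Vin Ein n) :
    ∃ P : Network Δ c Vin Ein n, P.records = C := by
  obtain ⟨hlen, hrec, hsort, hnet⟩ := mem_nets.1 hC
  let x : Fin n → NodeRecord Vin Ein := fun i => C[(i : ℕ)]'(by omega)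
  have hx (i) : x i ∈ C := List.getElem_mem _
  have hxC (y) (hy : y ∈ C) : ∃ i, x i = y := by
    obtain ⟨i, hi, rfl⟩ := List.getElem_of_mem hy
    exact ⟨⟨i, by omega⟩, rfl⟩
  have hmono : StrictMono fun i => (x i).1 := fun i j hij =>
    List.pairwise_iff_getElem.1 hsort i j _ _ hij
  have hinj : Function.Injective fun i => (x i).1 := hmono.injective
  have hnb (i : Fin n) (k : Fin (x i).2.2.length) : ∃ j, (x i).2.2[k].2 = some (x j).1 ∧
      j ≠ i ∧ (x i).1 ∈ targets (x j) := by
    obtain ⟨y, hy, h1, h2, h3⟩ := (hnet _ (hx i)).2.2 (x i).2.2[k] (List.getElem_mem _)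
    obtain ⟨j, rfl⟩ := hxC y hy
    exact ⟨j, h1, fun h => h2 (h ▸ rfl), h3⟩
  choose nb h1 h2 h3 using hnb
  have hmem (i j : Fin n) : (x j).1 ∈ targets (x i) ↔ ∃ k, nb i k = j := by
    simp only [targets, List.mem_filterMap]
    constructor
    · rintro ⟨h, hh, he⟩
      obtain ⟨k, hk, rfl⟩ := List.getElem_of_mem hh
      refine ⟨⟨k, hk⟩, hinj (Option.some.inj ?_)⟩
      rw [← h1 i ⟨k, hk⟩, ← he]; rfl
    · rintro ⟨k, rfl⟩
      exact ⟨_, List.getElem_mem k.2, h1 i k⟩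
  let G : SimpleGraph (Fin n) :=
    { Adj := fun i j => (x j).1 ∈ targets (x i)
      symm := ⟨fun i j h => by
        obtain ⟨k, rfl⟩ := (hmem i j).1 h
        exact h3 i k⟩
      loopless := ⟨fun i h => by
        obtain ⟨k, hk⟩ := (hmem i i).1 h
        exact h2 i k hk⟩ }
  let port (i : Fin n) : Fin (x i).2.2.length ≃ G.neighborSet i :=
    Equiv.ofBijective (fun k => ⟨nb i k, (hmem i _).2 ⟨k, rfl⟩⟩) <| by
      refine ⟨fun k l hkl => ?_, fun j => ?_⟩
      · have hkl' : nb i k = nb i l := congrArg Subtype.val hkl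
        have hnd : ((x i).2.2.map Prod.snd).Nodup := (hnet _ (hx i)).2.1
        have := (List.nodup_iff_injective_getElem.1 hnd)
          (a₁ := ⟨k, by simp⟩) (a₂ := ⟨l, by simp⟩)
          (by simpa using (h1 i k).trans ((congrArg (fun j => some (x j).1) hkl').trans
            (h1 i l).symm))
        exact Fin.ext (Fin.mk.inj_iff.1 this)
      · obtain ⟨k, hk⟩ := (hmem i j).1 j.2
        exact ⟨k, Subtype.ext hk⟩
  let P : Network Δ c Vin Ein n :=
    { graph := G
      deg := fun i => (x i).2.2.length
      deg_le := fun i => (mem_recordList.1 (hrec _ (hx i))).2.1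
      port := port
      input := fun i => (x i).2.1
      halfInput := fun d => (x d.fst).2.2[(port d.fst).symm ⟨d.snd, d.adj⟩].1
      ident := fun i => (x i).1
      ident_injective := hinj
      ident_mem := fun i => Finset.mem_Icc.2
        ⟨(hnet _ (hx i)).1, (mem_recordList.1 (hrec _ (hx i))).1⟩ }
  refine ⟨P, ?_⟩
  have hs : P.sorted (fun _ => True) = List.finRange n := by
    refine (P.eq_sorted (List.nodup_finRange _) (by simp) ?_).symm
    exact (List.pairwise_lt_finRange n).imp fun h => (hmono h).le
  have hg (i : Fin n) : P.genRecord P.graph.Adj i = x i := by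
    refine Prod.ext rfl (Prod.ext rfl ?_)
    refine Eq.trans ?_ List.ofFn_getElem
    refine congrArg List.ofFn (funext fun k => Prod.ext ?_ ?_)
    · exact congrArg (fun k : Fin (x i).2.2.length => (x i).2.2[k].1)
        ((port i).symm_apply_apply k)
    · exact (if_pos (port i k).2).trans (h1 i k).symm
  rw [records, hs]
  refine List.ext_getElem (by simp [hlen]) fun i hi hi' => ?_
  simp [hg, x]

end Network

/-! ### Local checkability in terms of records -/

section Matching

variable {Δ c Vin Ein Vout Eout : ℕ} {n : ℕ+}

/-- Half-edge labels can be specified by a list of labels for each node, in the order of ports. -/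
theorem Network.exists_half_labels (P : Network Δ c Vin Ein n) (F : Fin n → List (Fin Eout))
    (hF : ∀ u, (F u).length = P.deg u) :
    ∃ z : P.graph.Dart → Fin Eout, ∀ u, F u = List.ofFn fun i => z (P.dart u i) := by
  refine ⟨fun d => (F d.fst)[(P.port d.fst).symm ⟨d.snd, d.adj⟩]'(by rw [hF]; exact Fin.is_lt _),
    fun u => ?_⟩
  refine List.ext_getElem (by simp [hF]) fun i hi hi' => ?_
  rw [List.getElem_ofFn]
  exact congrArg (fun k : Fin (P.deg u) => (F u)[(k : ℕ)]'(by rw [hF]; exact k.2))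
    ((P.port u).symm_apply_apply ⟨i, by rwa [hF] at hi⟩).symm

/-- The check on records decides the local constraint at `v`. -/
theorem matchesRecords_iff {P : Network Δ c Vin Ein n} {y : Fin n → Fin Vout}
    {z : P.graph.Dart → Fin Eout} {out : ℕ → Output Vout Eout}
    (hout : ∀ u, out (P.ident u) = (y u, List.ofFn fun i => z (P.dart u i)))
    (d₀ : Labeled Vin Ein Vout Eout) (p : Pattern (Fin Vin × Fin Vout) (Fin Ein × Fin Eout))
    (r : ℕ) (v : Fin n) :
    MatchesRecords d₀ p ((P.view v r).2.map fun x => (x, out x.1)) (P.ident v) ↔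
      LCL.Matches p r P y z v := by
  classical
  let H := neighborhood P.graph v r
  let lab (u : Fin n) : Labeled Vin Ein Vout Eout := (P.genRecord H.Adj u, out (P.ident u))
  have hE (u w) (h : H.Adj u w) : P.graph.Adj u w := h.1
  have hD : (P.view v r).2.map (fun x => (x, out x.1)) =
      (P.sorted fun u => P.graph.edist v u ≤ r).map lab := by
    rw [P.view_eq, Network.genView, List.map_map]; rfl
  have hmem (d) : d ∈ (P.view v r).2.map (fun x => (x, out x.1)) ↔ ∃ u ∈ H.verts, lab u = d := by
    rw [hD, List.mem_map]
    simp only [Network.mem_sorted]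
    rfl
  have hlen (u) : (lab u).1.2.2.length = P.deg u := by simp [lab, Network.genRecord]
  -- The half-edge labels of `u` at the port leading to `w`.
  have hhalf (u w : Fin n) (h : H.Adj u w) (q : Fin Ein × Fin Eout) :
      (∃ k < P.deg u, (lab u).1.2.2[k]? = some (q.1, some (lab w).1.1) ∧
        (lab u).2.2[k]? = some q.2) ↔
      q = (P.halfInput ⟨(u, w), h.1⟩, z ⟨(u, w), h.1⟩) := by
    have hport (i : Fin (P.deg u)) : (if H.Adj u (P.port u i) then some (P.ident (P.port u i))
        else none) = some (P.ident w) ↔ P.port u i = ⟨w, h.1⟩ := by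
      constructor
      · intro hi
        split_ifs at hi with h'
        exact Subtype.ext (P.ident_injective (Option.some.inj hi))
      · intro hi; rw [hi]; exact if_pos h
    have hdart (i : Fin (P.deg u)) (hi : P.port u i = ⟨w, h.1⟩) :
        P.dart u i = ⟨(u, w), h.1⟩ := by
      ext <;> simp [Network.dart, hi]
    have hl : (lab u).2.2 = List.ofFn fun i => z (P.dart u i) := congrArg Prod.snd (hout u)
    rw [hl]
    constructor
    · rintro ⟨k, hk, e1, e2⟩
      simp only [lab, Network.genRecord, List.getElem?_ofFn, hk, dif_pos, Option.some.injEq,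
        Prod.mk.injEq] at e1
      simp only [List.getElem?_ofFn, hk, dif_pos, Option.some.injEq] at e2
      have hi := hdart ⟨k, hk⟩ ((hport _).1 (by convert e1.2))
      rw [hi] at e1 e2
      exact Prod.ext e1.1.symm e2.symm
    · rintro rfl
      have hi : P.port u ((P.port u).symm ⟨w, h.1⟩) = ⟨w, h.1⟩ := Equiv.apply_symm_apply _ _
      refine ⟨(P.port u).symm ⟨w, h.1⟩, Fin.is_lt _, ?_, ?_⟩
      · simp only [lab, Network.genRecord, List.getElem?_ofFn, Fin.is_lt, dif_pos, Fin.eta,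
          hdart _ hi]
        refine congrArg (fun o => some (_, o)) ?_
        convert (hport _).2 hi
      · simp only [List.getElem?_ofFn, Fin.is_lt, dif_pos, Fin.eta, hdart _ hi]
  constructor
  · rintro ⟨l, hl, hm⟩
    obtain ⟨hlp, hl⟩ := mem_lists.1 hl
    have hx (i : Fin p.size) : ∃ u ∈ H.verts, lab u = l.getD i d₀ := by
      rw [← hmem, List.getD_eq_getElem _ _ (by omega)]
      exact hl _ (List.getElem_mem _)
    choose x hxv hxl using hx
    simp only [← hxl] at hm
    have hbij : Function.Bijective fun i => (⟨x i, hxv i⟩ : H.verts) := by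
      refine ⟨fun i j hij => by_contra fun hne => hm.inj i j hne ?_, fun u => ?_⟩
      · rw [show x i = x j from congrArg Subtype.val hij]
      · obtain ⟨i, hi⟩ := hm.surj _ ((hmem _).2 ⟨u, u.2, rfl⟩)
        exact ⟨i, Subtype.ext (P.ident_injective hi)⟩
    have hadj (i j) : H.Adj (x i) (x j) ↔ p.graph.Adj i j := by
      rw [hm.adj, P.mem_targets hE]
      constructor
      · exact fun h => ⟨_, h, rfl⟩
      · rintro ⟨w, hw, he⟩
        rwa [P.ident_injective he] at hw
    refine ⟨⟨Equiv.ofBijective _ hbij, fun {i j} => hadj i j⟩, P.ident_injective hm.root,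
      fun i => (hm.deg i).symm.trans (hlen _), fun i => ?_, fun i j h => ?_⟩
    · rw [← hm.node i]
      exact Prod.ext rfl (congrArg Prod.fst (hout _))
    · exact (hhalf _ _ ((hadj i j).2 h) _).1 (by
        have := hm.half i j h
        rwa [← hm.deg i, hlen] at this)
  · rintro ⟨φ, hroot, hdeg, hnode, hhe⟩
    refine ⟨List.ofFn fun i => lab (φ i), mem_lists.2 ⟨by simp, fun d hd => ?_⟩, ?_⟩
    · obtain ⟨i, rfl⟩ := (List.mem_ofFn' _ _).1 hd
      exact (hmem _).2 ⟨_, (φ i).2, rfl⟩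
    have hget (i : Fin p.size) : (List.ofFn fun i => lab (φ i)).getD i d₀ = lab (φ i) := by
      rw [List.getD_eq_getElem _ _ (by simp)]; simp
    simp only [hget]
    have hadj (i j) : H.Adj (φ i) (φ j) ↔ p.graph.Adj i j := φ.map_adj_iff
    refine ⟨fun i j hne h => hne (φ.injective (Subtype.ext (P.ident_injective h))), fun d hd => ?_,
      congrArg P.ident hroot, fun i => (hlen _).trans (hdeg i).symm, fun i => ?_, fun i j => ?_,
      fun i j h => ?_⟩
    · obtain ⟨u, hu, rfl⟩ := (hmem d).1 hd
      exact ⟨φ.symm ⟨u, hu⟩, by simp⟩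
    · rw [hnode i]
      exact Prod.ext rfl (congrArg Prod.fst (hout _))
    · rw [← hadj, P.mem_targets hE]
      constructor
      · exact fun h => ⟨_, h, rfl⟩
      · rintro ⟨w, hw, he⟩
        rwa [P.ident_injective he] at hw
    · rw [hdeg i]
      exact (hhalf _ _ ((hadj i j).2 h) _).2 (hhe i j h)

end Matching

/-! ### The computable algorithm -/

variable {Δ c Vin Ein Vout Eout : ℕ}

/-- The bounds on the running time for all admissible sizes can be computed. -/
theorem exists_computable_bounds {T : ℕ+ → ℕ} (hT : ComputableBound T) {f : ℕ+ → ℕ∞}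
    (hf : ComputableExtBound f) : ∃ B : ℕ → List (ℕ × ℕ), Computable B ∧
      ∀ N b, b ∈ B N ↔ ∃ n : ℕ+, Admissible f n N ∧ b = ((n : ℕ), T n) := by
  obtain ⟨g, hg, hfg⟩ := hf
  obtain ⟨q, hq, hqf⟩ : ∃ q : ℕ × ℕ → Bool, Computable q ∧
      ∀ N k, q (N, k) = true ↔ (N : ℕ∞) ≤ f k.succPNat := by
    refine ⟨fun x => Option.casesOn (g x.2) true fun m => decide (x.1 ≤ m),
      Computable.option_casesOn (f := fun _ => true) (g := fun x m => decide (x.1 ≤ m))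
        (hg.comp Computable.snd) (Computable.const true) ?_,
      fun N k => ?_⟩
    · exact (PrimrecPred.decide (p := fun x : (ℕ × ℕ) × ℕ => x.1.1 ≤ x.2)
        (Primrec.nat_le.comp (Primrec.fst.comp Primrec.fst) Primrec.snd)).to_comp
    · rw [hfg]
      dsimp only
      generalize g k = o
      cases o <;> simp
  have hh : Computable fun x : ℕ × ℕ =>
      bif q x then some (x.2 + 1, T x.2.succPNat) else none :=
    Computable.cond hq (Computable.option_some.comp
      ((Computable.succ.comp Computable.snd).pair
        (Computable.comp (f := fun k : ℕ => T k.succPNat) hT Computable.snd)))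
      (Computable.const none)
  refine ⟨_, Computable.filterMap_range hh, fun N b => ?_⟩
  rw [List.mem_filterMap]
  constructor
  · rintro ⟨k, hk, hb⟩
    cases hc : q (N, k) with
    | false => simp [hc] at hb
    | true =>
      rw [hc, cond_true, Option.some.injEq] at hb
      exact ⟨k.succPNat, ⟨List.mem_range.1 hk, (hqf N k).1 hc⟩, hb.symm⟩
  · rintro ⟨n, ⟨hn, hN⟩, rfl⟩
    have hk : n.natPred.succPNat = n := n.succPNat_natPred
    have hn' : n.natPred + 1 = n := n.natPred_add_one
    refine ⟨n.natPred, List.mem_range.2 (by omega), ?_⟩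
    rw [(hqf N n.natPred).2 (by rwa [hk]), cond_true, hk, hn']

theorem firstOut_eq {σ : Type*} {o₀ o : σ} {R : ℕ → Option σ} {t m : ℕ} (htm : t ≤ m)
    (ht : R t = some o) (hlt : ∀ s < t, R s = none) : firstOut o₀ R m = o := by
  obtain ⟨d, rfl⟩ := Nat.exists_eq_add_of_le htm
  have h : (List.range t).filterMap R = [] :=
    List.filterMap_eq_nil_iff.2 fun s hs => hlt s (List.mem_range.1 hs)
  rw [firstOut, add_assoc, List.range_add, List.filterMap_append, h, List.range_succ_eq_map]
  simp [ht]

theorem lookup_map_self {κ σ : Type*} [BEq κ] [LawfulBEq κ] (F : κ → σ) {l : List κ} {k : κ}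
    (hk : k ∈ l) : (l.map fun k => (k, F k)).lookup k = some (F k) := by
  induction l with
  | nil => simp at hk
  | cons a l ih =>
    rw [List.map_cons, List.lookup_cons]
    by_cases h : k = a
    · subst h; simp
    · rw [beq_false_of_ne h]
      exact ih ((List.mem_cons.1 hk).resolve_left h)

theorem runTable_eq_some {o₀ o : Output Vout Eout} {B : List (ℕ × ℕ)}
    {τ : Table Vin Ein Vout Eout} {X : View Vin Ein} {t : ℕ} :
    runTable Δ c o₀ B τ X t = some o ↔
      Stops Δ c B X t ∧ (τ.lookup (X, cap X t)).getD o₀ = o := by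
  unfold runTable
  split_ifs with h <;> simp [h]

theorem runTable_ne_none {o₀ : Output Vout Eout} {B : List (ℕ × ℕ)}
    {τ : Table Vin Ein Vout Eout} {X : View Vin Ein} {t : ℕ} :
    runTable Δ c o₀ B τ X t ≠ none ↔ Stops Δ c B X t := by
  unfold runTable
  split_ifs with h <;> simp [h]

/-- The algorithm that stops as late as possible, with outputs from a table for each `N`. -/
noncomputable def tableAlgorithm (Δ c : ℕ) (o₀ : Output Vout Eout) (B : ℕ → List (ℕ × ℕ))
    (τ : ℕ → Table Vin Ein Vout Eout) : Algorithm Δ c Vin Ein Vout Eout where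
  run N X t := runTable Δ c o₀ (B N) (τ N) X t
  sensible N n P v r e he t ht := by
    have hSt (t) (ht : e + 1 ≤ t) : Stops Δ c (B N) (P.view v r) t :=
      Or.inl (by rw [P.rad_view he, min_eq_right (by omega)]; omega)
    have hcap (t) (ht : e + 1 ≤ t) : cap (P.view v r) t = e + 1 := by
      rw [cap, P.rad_view he, min_eq_right (by omega : e ≤ t), min_eq_right ht]
    refine ⟨?_, runTable_ne_none.2 (hSt t ht)⟩
    rw [runTable, runTable, if_pos (hSt t ht), if_pos (hSt _ le_rfl), hcap t ht,
      hcap _ le_rfl]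

theorem isComputable_tableAlgorithm {o₀ : Output Vout Eout} {B : ℕ → List (ℕ × ℕ)}
    {τ : ℕ → Table Vin Ein Vout Eout} (hB : Computable B) (hτ : Computable τ) :
    (tableAlgorithm Δ c o₀ B τ).IsComputable := by
  let F (x : (List (ℕ × ℕ) × Table Vin Ein Vout Eout) × View Vin Ein × ℕ) :
      Option (Output Vout Eout) := runTable Δ c o₀ x.1.1 x.1.2 x.2.1 x.2.2
  have hF : Primrec F :=
    primrec_runTable (Primrec.fst.comp Primrec.fst) (Primrec.snd.comp Primrec.fst)
      (Primrec.fst.comp Primrec.snd) (Primrec.snd.comp Primrec.snd)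
  have hG : Computable fun a : ℕ × View Vin Ein × ℕ => ((B a.1, τ a.1), a.2) :=
    ((hB.comp Computable.fst).pair (hτ.comp Computable.fst)).pair Computable.snd
  have h2 : Computable fun a : ℕ × View Vin Ein × ℕ => F ((B a.1, τ a.1), a.2) :=
    Computable.comp hF.to_comp hG
  exact h2

section Correctness

variable {T : ℕ+ → ℕ} {f : ℕ+ → ℕ∞} {N : ℕ} {B : List (ℕ × ℕ)} {n : ℕ+}

/-- Every algorithm that runs within `T` has stopped by the time where it has to: its behavior up
to round `t` depends only on the view in round `t`, which may as well come from a network for which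
the bound on the running time is at most `t`. -/
theorem exists_run_ne_none_of_stops {A : Algorithm Δ c Vin Ein Vout Eout} (hAT : A.RunsWithin f T)
    (hB : ∀ b, b ∈ B ↔ ∃ n : ℕ+, Admissible f n N ∧ b = ((n : ℕ), T n))
    {P : Network Δ c Vin Ein n} {v : Fin n} {t : ℕ} (h : Stops Δ c B (P.view v t) t) :
    ∃ s ≤ cap (P.view v t) t, A.run N (P.view v s) s ≠ none := by
  obtain ⟨e, he⟩ := P.exists_hasRadius v t
  rcases lt_or_ge e t with het | het
  · refine ⟨e + 1, by simp [cap, P.rad_view he]; omega, ?_⟩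
    exact (A.sensible N n P v (e + 1) e (he.of_lt P het) (e + 1) le_rfl).2
  · have hrad : rad (P.view v t) t = t := by rw [P.rad_view he, min_eq_left het]
    rcases h with h | ⟨b, hb, hbt, C, hC, x, hx, hX⟩
    · omega
    · obtain ⟨n', hn', rfl⟩ := (hB b).1 hb
      obtain ⟨P', rfl⟩ := Network.exists_records_eq hC
      obtain ⟨u, rfl⟩ := Network.mem_records.1 hx
      obtain ⟨s, hs, hrun⟩ := hAT n' P' N hn' u
      have hst : s ≤ t := hs.trans hbt
      refine ⟨s, by rw [cap, hrad]; omega, ?_⟩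
      have hX' : P'.view u t = P.view v t := (P'.restrict_records u t).symm.trans hX
      rwa [← P.restrict_view hst, ← hX', P'.restrict_view hst]

/-- In round `T n` the view of a node of an admissible network on `n` nodes forces itself. -/
theorem stops_of_admissible
    (hB : ∀ b, b ∈ B ↔ ∃ n : ℕ+, Admissible f n N ∧ b = ((n : ℕ), T n))
    (hn : Admissible f n N) (P : Network Δ c Vin Ein n) (v : Fin n) :
    Stops Δ c B (P.view v (T n)) (T n) :=
  Or.inr ⟨_, (hB _).2 ⟨n, hn, rfl⟩, le_rfl, _, P.records_mem_nets, _,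
    Network.mem_records.2 ⟨v, rfl⟩, P.restrict_records v (T n)⟩

/-- On an admissible network, `tableOut` is the output of the algorithm given by the table. -/
theorem exists_runTable_eq_tableOut
    (hB : ∀ b, b ∈ B ↔ ∃ n : ℕ+, Admissible f n N ∧ b = ((n : ℕ), T n))
    (hn : Admissible f n N) (P : Network Δ c Vin Ein n) (v : Fin n) (o₀ : Output Vout Eout)
    (τ : Table Vin Ein Vout Eout) : ∃ t ≤ T n,
      runTable Δ c o₀ B τ (P.view v t) t =
        some (tableOut Δ c o₀ B τ P.records (T n) (P.ident v)) ∧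
      ∀ s < t, runTable Δ c o₀ B τ (P.view v s) s = none := by
  classical
  have hex : ∃ t, runTable Δ c o₀ B τ (P.view v t) t ≠ none :=
    ⟨T n, runTable_ne_none.2 (stops_of_admissible hB hn P v)⟩
  have hle : Nat.find hex ≤ T n :=
    Nat.find_min' hex (runTable_ne_none.2 (stops_of_admissible hB hn P v))
  have hlt (s) (hs : s < Nat.find hex) : runTable Δ c o₀ B τ (P.view v s) s = none :=
    not_not.1 (Nat.find_min hex hs)
  obtain ⟨o, ho⟩ := Option.ne_none_iff_exists'.1 (Nat.find_spec hex)
  refine ⟨_, hle, ?_, hlt⟩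
  rw [ho, tableOut]
  simp only [P.restrict_records]
  rw [firstOut_eq (R := fun t => runTable Δ c o₀ B τ (P.view v t) t) hle ho hlt]

/-- The outputs of `A` at the stopping times of the algorithm given by a table form a good table. -/
theorem exists_goodTable {L : LCL Vin Ein Vout Eout} {A : Algorithm Δ c Vin Ein Vout Eout}
    (hA : A.Solves f L) (hAT : A.RunsWithin f T)
    (hB : ∀ b, b ∈ B ↔ ∃ n : ℕ+, Admissible f n N ∧ b = ((n : ℕ), T n))
    (d₀ : Labeled Vin Ein Vout Eout) : ∃ τ, GoodTable Δ c L d₀ B τ := by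
  let F (k : View Vin Ein × ℕ) : Output Vout Eout :=
    firstOut d₀.2 (fun s => A.run N (restrict k.1 s) s) k.2
  -- All pairs at which an output is ever looked up on an admissible network.
  let K : List (View Vin Ein × ℕ) := B.flatMap fun b => (nets Δ c Vin Ein b.1).flatMap fun C =>
    C.flatMap fun x => (List.range (b.2 + 1)).map fun t =>
      (restrict (x.1, C) t, cap (restrict (x.1, C) t) t)
  refine ⟨K.map fun k => (k, F k), fun b hb C hC x hx => ?_⟩
  obtain ⟨n, hn, rfl⟩ := (hB b).1 hb
  obtain ⟨P, rfl⟩ := Network.exists_records_eq hC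
  obtain ⟨u, rfl⟩ := Network.mem_records.1 hx
  obtain ⟨y, z, hout, hsol⟩ := hA n P N hn
  have hkey (v : Fin n) : tableOut Δ c d₀.2 B (K.map fun k => (k, F k)) P.records (T n)
      (P.ident v) = (y v, List.ofFn fun i => z (P.dart v i)) := by
    obtain ⟨t, ht, hrun, -⟩ := exists_runTable_eq_tableOut hB hn P v d₀.2 (K.map fun k => (k, F k))
    obtain ⟨hSt, hlook⟩ := runTable_eq_some.1 hrun
    rw [← hlook]
    have hK : (P.view v t, cap (P.view v t) t) ∈ K := by
      refine List.mem_flatMap.2 ⟨_, hb, List.mem_flatMap.2 ⟨_, P.records_mem_nets,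
        List.mem_flatMap.2 ⟨_, Network.mem_records.2 ⟨v, rfl⟩, List.mem_map.2 ⟨t, ?_, ?_⟩⟩⟩⟩
      · exact List.mem_range.2 (Nat.lt_succ_of_le ht)
      · show (restrict (P.ident v, P.records) t, cap (restrict (P.ident v, P.records) t) t) = _
        rw [P.restrict_records]
    rw [lookup_map_self F hK, Option.getD_some]
    obtain ⟨t₁, ho, hlt⟩ := hout v
    obtain ⟨s, hs, hne⟩ := exists_run_ne_none_of_stops hAT hB hSt
    have ht₁ : t₁ ≤ cap (P.view v t) t :=
      (not_lt.1 fun h => hne (hlt s h)).trans hs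
    have hcap : cap (P.view v t) t ≤ t := min_le_left _ _
    refine firstOut_eq ht₁ ?_ fun s hs => ?_
    · rw [P.restrict_view (by omega)]; exact ho
    · rw [P.restrict_view (by omega)]; exact hlt s hs
  obtain ⟨p, hp, hm⟩ := hsol u
  refine ⟨?_, p, hp, ?_⟩
  · show (tableOut _ _ _ _ _ _ _ (P.ident u)).2.length = _
    rw [hkey u]
    simp [Network.genRecord]
  · show MatchesRecords d₀ p ((restrict (P.ident u, P.records) _).2.map _) (P.ident u)
    rw [P.restrict_records]
    exact (matchesRecords_iff hkey d₀ p _ u).2 hm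

/-- Conversely, the algorithm given by good tables solves the problem. -/
theorem solves_tableAlgorithm {L : LCL Vin Ein Vout Eout} {B : ℕ → List (ℕ × ℕ)}
    (hB : ∀ N b, b ∈ B N ↔ ∃ n : ℕ+, Admissible f n N ∧ b = ((n : ℕ), T n))
    {d₀ : Labeled Vin Ein Vout Eout} {τ : ℕ → Table Vin Ein Vout Eout}
    (hτ : ∀ N, GoodTable Δ c L d₀ (B N) (τ N)) :
    (tableAlgorithm Δ c d₀.2 B τ).Solves f L := by
  intro n P N hn
  have hgood (u : Fin n) := hτ N _ ((hB N _).2 ⟨n, hn, rfl⟩) _ P.records_mem_nets _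
    (Network.mem_records.2 ⟨u, rfl⟩)
  let out (a : ℕ) := tableOut Δ c d₀.2 (B N) (τ N) P.records (T n) a
  obtain ⟨z, hz⟩ := P.exists_half_labels (fun u => (out (P.ident u)).2) fun u =>
    (hgood u).1.trans (by simp [Network.genRecord])
  have hout (u) : out (P.ident u) = ((out (P.ident u)).1, List.ofFn fun i => z (P.dart u i)) :=
    Prod.ext rfl (hz u)
  refine ⟨fun u => (out (P.ident u)).1, z, fun v => ?_, fun v => ?_⟩
  · obtain ⟨t, -, ho, hlt⟩ := exists_runTable_eq_tableOut (hB N) hn P v d₀.2 (τ N)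
    exact ⟨t, ho.trans (congrArg some (hout v)), hlt⟩
  · obtain ⟨p, hp, hm⟩ := (hgood v).2
    have hm' : MatchesRecords d₀ p ((restrict (P.ident v, P.records) L.radius).2.map
      fun x => (x, out x.1)) (P.ident v) := hm
    rw [P.restrict_records] at hm'
    exact ⟨p, hp, (matchesRecords_iff hout d₀ p _ v).1 hm'⟩

end Correctness

/-- If there is a network at all, then a sensible algorithm has an output on it, so the alphabets
of inputs and outputs for nodes are not empty. -/
theorem Algorithm.nonempty_labeled (A : Algorithm Δ c Vin Ein Vout Eout) {n : ℕ+}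
    (P : Network Δ c Vin Ein n) : Nonempty (Labeled Vin Ein Vout Eout) := by
  let v : Fin n := ⟨0, n.pos⟩
  obtain ⟨e, he⟩ := P.exists_hasRadius v 0
  obtain ⟨o, -⟩ := Option.ne_none_iff_exists'.1 (A.sensible 0 n P v 0 e he (e + 1) le_rfl).2
  exact ⟨P.genRecord P.graph.Adj v, o⟩

end LocalModel

theorem mainTheorem2 (Δ c : ℕ) (hc : 0 < c) (Vin Ein Vout Eout : ℕ)
    (L : LocalModel.LCL Vin Ein Vout Eout)
    (T : ℕ+ → ℕ) (hT : Monotone T) (hTc : LocalModel.ComputableBound T)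
    (f : ℕ+ → ℕ∞) (hf : Monotone f) (hfc : LocalModel.ComputableExtBound f)
    (A : LocalModel.Algorithm Δ c Vin Ein Vout Eout)
    (hA : A.Solves f L) (hAT : A.RunsWithin f T) :
    ∃ B : LocalModel.Algorithm Δ c Vin Ein Vout Eout,
      B.IsComputable ∧ B.Solves f L ∧ B.RunsWithin f T ∧
        (A.IsLocality f T → B.IsLocality f T) := by
  by_cases hne : Nonempty (LocalModel.Labeled Vin Ein Vout Eout)
  · obtain ⟨d₀⟩ := hne
    obtain ⟨B, hBc, hB⟩ := LocalModel.exists_computable_bounds hTc hfc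
    obtain ⟨τ, hτc, hτ⟩ := Computable.exists_choice hBc
      (R := fun b t => LocalModel.GoodTable Δ c L d₀ b t)
      (LocalModel.primrecPred_goodTable L d₀ Primrec.fst Primrec.snd) []
      fun N => LocalModel.exists_goodTable hA hAT (hB N) d₀
    have hrun : (LocalModel.tableAlgorithm Δ c d₀.2 B τ).RunsWithin f T := fun n P N hn v =>
      ⟨T n, le_rfl, LocalModel.runTable_ne_none.2 (LocalModel.stops_of_admissible (hB N) hn P v)⟩
    refine ⟨LocalModel.tableAlgorithm Δ c d₀.2 B τ, ?_, LocalModel.solves_tableAlgorithm hB hτ,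
      hrun, fun hloc => ⟨hrun, fun T' hT' => hloc.2 fun n P N hn v => ?_⟩⟩
    · exact LocalModel.isComputable_tableAlgorithm hBc hτc
    · -- A bound on the rounds of the new algorithm bounds the rounds of `A`, which stops no later.
      obtain ⟨t, ht, hne⟩ := hT' n P N hn v
      obtain ⟨s, hs, hs'⟩ := LocalModel.exists_run_ne_none_of_stops hAT (hB N)
        (LocalModel.runTable_ne_none.1 hne)
      exact ⟨s, hs.trans ((min_le_left _ _).trans ht), hs'⟩
  · -- There are no networks, so that the algorithm that never stops will do.
    have hno {n : ℕ+} (P : LocalModel.Network Δ c Vin Ein n) : False :=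
      hne (A.nonempty_labeled P)
    exact ⟨⟨fun _ _ _ => none, fun _ _ P => (hno P).elim⟩, Computable.const none,
      fun _ P => (hno P).elim, fun _ P => (hno P).elim,
      fun hloc => ⟨fun _ P => (hno P).elim, fun _ _ => hloc.2 fun _ P => (hno P).elim⟩⟩
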